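/- Let $X$ be a complex Hilbert space. Let $W^{1,2}([-1,0],X)$ be the space of absolutely continuous $f\in L^2([-1,0],X)$ with derivative $f'\in L^2([-1,0],X)$ (that is, $f(t)=f(0)+\int_0^t f'(s)\,ds$), normed by $(\|f\|_{L^2}^2+\|f'\|_{L^2}^2)^{1/2}$, and let $\Phi: W^{1,2}([-1,0],X)\to X$ be a bounded linear operator. For a linear operator $(B,D(B))$ on $X$ let $(\mathcal A,D(\mathcal A))$ be the delay operator matrix on $\mathcal E=X\times L^2([-1,0],X)$, $$\mathcal A\begin{pmatrix}x\\ f\end{pmatrix}=\begin{pmatrix}Bx+\Phi f\\ f'\end{pmatrix},\qquad D(\mathcal A)=\left\{\begin{pmatrix}x\\ f\end{pmatrix}\in D(B)\times W^{1,2}([-1,0],X): f(0)=x\right\}.$$ Let $A_0$ be the generator of the nilpotent left shift semigroup on $L^2([-1,0],X)$, i.e. $A_0f=f'$ with $D(A_0)=\{f\in W^{1,2}([-1,0],X): f(0)=0\}$. The operator $\Phi$ is called admissible if (a) for every generator $(B,D(B))$ of a strongly continuous semigroup on $X$ the corresponding operator $(\mathcal A,D(\mathcal A))$ generates a strongly continuous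 semigroup on $\mathcal E$, and (b) for every $\omega\in\mathbb R$ the function $\lambda\mapsto \Phi R(\lambda,A_0)\in\mathcal L(L^2([-1,0],X),X)$ is bounded and analytic on $\{\lambda\in\mathbb C:\operatorname{Re}\lambda>\omega\}$. For $\lambda\in\mathbb C$ define $\Phi_\lambda\in\mathcal L(X)$ by $\Phi_\lambda x=\Phi(e^{\lambda\cdot}x)$. A strongly continuous semigroup $(T(t))_{t\ge0}$ on a Banach space $E$ is called hyperbolic if $E=E_s\oplus E_u$ with closed $T(t)$-invariant subspaces such that $T(t)$ is uniformly exponentially stable on $E_s$, while on $E_u$ the operators $T(t)$ are invertible and their inverses $T(t)^{-1}$ are uniformly exponentially stable. **Theorem.** Assume that $\Phi$ is admissible and that $(B,D(B))$ generates a hyperbolic semigroup on $X$ (so that $i\mathbb R\subset\rho(B)$). Put $$a_n:=\sup_{\omega\in\mathbb R}\left\|(\Phi_{i\omega}R(i\omega,B))^n\right\|,\qquad n\ge 0.$$ If $\sum_{n=0}^\infty a_n<\infty$ (in particular all $a_n<\infty$), then $(\mathcal A,D(\mathcal A))$ generates a hyperbolic semigroup on $\mathcal E$. -/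

import Mathlib

open MeasureTheory Set Filter Topology
open scoped NNReal ENNReal

namespace DelayEq

/-! ### Unbounded operators: resolvents -/

section Operators

variable {E : Type*} [NormedAddCommGroup E] [NormedSpace ℂ E]

/-- `R` is a bounded two-sided inverse of `z - A : D(A) → E`. -/
def IsResolventAt (A : E →ₗ.[ℂ] E) (z : ℂ) (R : E →L[ℂ] E) : Prop :=
  (∀ y : E, ∃ h : R y ∈ A.domain, z • R y - A ⟨R y, h⟩ = y) ∧
    ∀ x : A.domain, R (z • (x : E) - A x) = x

/-- The resolvent set `ρ(A)`. -/
def resolventSet (A : E →ₗ.[ℂ] E) : Set ℂ := {z | ∃ R, IsResolventAt A z R}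

open Classical in
/-- The resolvent `R(z, A) = (z - A)⁻¹` for `z ∈ ρ(A)` (and `0` for `z ∉ ρ(A)`). -/
noncomputable def resolventOp (A : E →ₗ.[ℂ] E) (z : ℂ) : E →L[ℂ] E :=
  if h : ∃ R, IsResolventAt A z R then h.choose else 0

theorem resolventOp_mem_domain (A : E →ₗ.[ℂ] E) (z : ℂ) (y : E) :
    resolventOp A z y ∈ A.domain := by
  unfold resolventOp
  split_ifs with h
  · exact (h.choose_spec.1 y).choose
  · simp

/-- A strongly continuous semigroup of bounded operators on `E`. -/
structure C0Semigroup (E : Type*) [NormedAddCommGroup E] [NormedSpace ℂ E] where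
  /-- the operators `T(t)`, `t ≥ 0` -/
  op : ℝ≥0 → E →L[ℂ] E
  op_zero : op 0 = ContinuousLinearMap.id ℂ E
  op_add : ∀ s t, op (s + t) = (op s).comp (op t)
  continuous_orbit : ∀ x, Continuous fun t => op t x

/-- `A` is the generator of `T`: `x ∈ D(A)` and `A x = y` if and only if
`(T(t) x - x) / t → y` as `t ↓ 0`. -/
def C0Semigroup.IsGenerator (T : C0Semigroup E) (A : E →ₗ.[ℂ] E) : Prop :=
  ∀ x y : E, (x, y) ∈ A.graph ↔
    Tendsto (fun t : ℝ≥0 => (t : ℝ)⁻¹ • (T.op t x - x)) (𝓝[>] 0) (𝓝 y)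

/-- `A` generates some strongly continuous semigroup. -/
def GeneratesC0Semigroup (A : E →ₗ.[ℂ] E) : Prop :=
  ∃ T : C0Semigroup E, T.IsGenerator A

/-- Hyperbolic semigroup: `E = E_s ⊕ E_u` with closed `T(t)`-invariant subspaces, such that
`T(t)` is uniformly exponentially stable on `E_s`, and on `E_u` the operators `T(t)` are invertible
and the inverses are uniformly exponentially stable. -/
def C0Semigroup.IsHyperbolic (T : C0Semigroup E) : Prop :=
  ∃ Es Eu : Submodule ℂ E, IsClosed (Es : Set E) ∧ IsClosed (Eu : Set E) ∧ IsCompl Es Eu ∧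
    (∀ t, MapsTo (T.op t) Es Es) ∧ (∀ t, BijOn (T.op t) Eu Eu) ∧
    ∃ M ε : ℝ, 0 < ε ∧
      (∀ t : ℝ≥0, ∀ x ∈ Es, ‖T.op t x‖ ≤ M * Real.exp (-ε * t) * ‖x‖) ∧
      (∀ t : ℝ≥0, ∀ x ∈ Eu, ‖x‖ ≤ M * Real.exp (-ε * t) * ‖T.op t x‖)

/-- `A` generates a hyperbolic strongly continuous semigroup. -/
def GeneratesHyperbolicSemigroup (A : E →ₗ.[ℂ] E) : Prop :=
  ∃ T : C0Semigroup E, T.IsGenerator A ∧ T.IsHyperbolic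

end Operators

/-! ### The spaces `L²([-1,0], X)` and `W^{1,2}([-1,0], X)` -/

/-- Lebesgue measure on the history interval `[-1,0]`. -/
noncomputable abbrev histMeasure : Measure ℝ := volume.restrict (Icc (-1 : ℝ) 0)

/-- `L²([-1,0], X)`. -/
abbrev L2 (X : Type*) [NormedAddCommGroup X] : Type _ := Lp X 2 histMeasure

set_option linter.unusedSectionVars false

section Sobolev

variable {X : Type*} [NormedAddCommGroup X] [InnerProductSpace ℂ X]

/-- `f` is (represented by) the absolutely continuous function on `[-1,0]` with derivative `g` and
with value `x` at `0`, i.e. `f(t) = x + ∫_0^t g(s) ds`. -/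
def IsPrimitive (x : X) (f g : L2 X) : Prop :=
  ∀ᵐ t ∂histMeasure, f t = x + ∫ s in (0 : ℝ)..t, g s

theorem intervalIntegrable_L2 (g : L2 X) {t : ℝ} (ht : t ∈ Icc (-1 : ℝ) 0) :
    IntervalIntegrable g volume 0 t := by
  have h : IntegrableOn g (Icc (-1 : ℝ) 0) volume := (Lp.memLp g).integrable (by norm_num)
  refine (h.mono_set ?_).intervalIntegrable
  rw [uIcc_of_ge ht.2]
  exact Icc_subset_Icc_left ht.1

theorem integral_congr_L2 {g h : ℝ → X} (hgh : g =ᵐ[histMeasure] h) {t : ℝ}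
    (ht : t ∈ Icc (-1 : ℝ) 0) : ∫ s in (0 : ℝ)..t, g s = ∫ s in (0 : ℝ)..t, h s := by
  apply intervalIntegral.integral_congr_ae
  rw [uIoc_of_ge ht.2]
  have := (ae_restrict_iff' measurableSet_Icc).1 hgh
  filter_upwards [this] with s hs hst
  exact hs ⟨ht.1.trans hst.1.le, hst.2⟩

theorem IsPrimitive.add [CompleteSpace X] {x y : X} {f g f' g' : L2 X} (h : IsPrimitive x f g)
    (h' : IsPrimitive y f' g') : IsPrimitive (x + y) (f + f') (g + g') := by
  filter_upwards [h, h', Lp.coeFn_add f f', ae_restrict_mem measurableSet_Icc] with t h1 h2 h3 ht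
  rw [h3, Pi.add_apply, h1, h2, integral_congr_L2 (Lp.coeFn_add g g') ht]
  simp only [Pi.add_apply]
  rw [intervalIntegral.integral_add (intervalIntegrable_L2 g ht) (intervalIntegrable_L2 g' ht)]
  abel

theorem IsPrimitive.smul [CompleteSpace X] (c : ℂ) {x : X} {f g : L2 X} (h : IsPrimitive x f g) :
    IsPrimitive (c • x) (c • f) (c • g) := by
  filter_upwards [h, Lp.coeFn_smul c f, ae_restrict_mem measurableSet_Icc] with t h1 h3 ht
  rw [h3, Pi.smul_apply, h1, integral_congr_L2 (Lp.coeFn_smul c g) ht]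
  simp only [Pi.smul_apply]
  rw [intervalIntegral.integral_smul, smul_add]

theorem isPrimitive_zero : IsPrimitive (0 : X) 0 0 := by
  filter_upwards [Lp.coeFn_zero X 2 histMeasure, ae_restrict_mem measurableSet_Icc] with t h1 ht
  rw [h1, integral_congr_L2 (Lp.coeFn_zero X 2 histMeasure) ht]
  simp

theorem IsPrimitive.eq_zero [CompleteSpace X] {x : X} {g : L2 X} (h : IsPrimitive x 0 g) :
    x = 0 ∧ g = 0 := by
  set F : ℝ → X := fun t => x + ∫ s in (0 : ℝ)..t, g s with hF
  have hint : IntegrableOn g (Icc (-1 : ℝ) 0) volume := (Lp.memLp g).integrable (by norm_num)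
  have hint' : IntegrableOn g (uIcc (-1 : ℝ) 0) volume := by
    rwa [uIcc_of_le (by norm_num)]
  have hcont : ContinuousOn F (Icc (-1 : ℝ) 0) := by
    have := intervalIntegral.continuousOn_primitive_interval' (a := (0 : ℝ))
      hint'.intervalIntegrable (by simp)
    rw [uIcc_of_le (by norm_num : (-1 : ℝ) ≤ 0)] at this
    exact continuousOn_const.add this
  have hae : F =ᵐ[histMeasure] fun _ => (0 : X) := by
    filter_upwards [h, Lp.coeFn_zero X 2 histMeasure] with t h1 h2
    rw [hF]
    simp only
    rw [← h1, h2, Pi.zero_apply]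
  have hzero : EqOn F (fun _ => 0) (Icc (-1 : ℝ) 0) :=
    Measure.eqOn_Icc_of_ae_eq volume (by norm_num) hae hcont continuousOn_const
  refine ⟨by simpa [hF] using hzero (x := 0) (by simp), ?_⟩
  apply Lp.ext
  have hd := hint'.intervalIntegrable.ae_hasDerivAt_integral
  have h0 : ∀ᵐ t : ℝ, t ≠ 0 := by simp [ae_iff]
  have h1 : ∀ᵐ t : ℝ, t ≠ -1 := by simp [ae_iff]
  refine EventuallyEq.trans ?_ (Lp.coeFn_zero X 2 histMeasure).symm
  refine (ae_restrict_iff' measurableSet_Icc).2 ?_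
  filter_upwards [hd, h0, h1] with t ht ht0 ht1 htm
  have hder := ht (by rwa [uIcc_of_le (by norm_num)]) 0 (by simp)
  have hder' : HasDerivAt F (g t) t := by simpa [hF] using hder.const_add x
  have hz : HasDerivAt F 0 t := by
    refine (hasDerivAt_const t (0 : X)).congr_of_eventuallyEq ?_
    filter_upwards [Icc_mem_nhds (lt_of_le_of_ne htm.1 (Ne.symm ht1)) (lt_of_le_of_ne htm.2 ht0)]
      with s hs using hzero hs
  simpa using hder'.unique hz

theorem IsPrimitive.unique [CompleteSpace X] {x y : X} {f g g' : L2 X} (h : IsPrimitive x f g)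
    (h' : IsPrimitive y f g') : x = y ∧ g = g' := by
  have := h.add (h'.smul (-1))
  simp only [neg_smul, one_smul, add_neg_cancel] at this
  have h0 := this.eq_zero
  exact ⟨by simpa [add_neg_eq_zero] using h0.1, by simpa [add_neg_eq_zero] using h0.2⟩

variable (X) in
/-- `W^{1,2}([-1,0], X)`: the space of all pairs `(f, f')`, where `f ∈ L²` is absolutely continuous
with derivative `f' ∈ L²`, with the graph norm `(‖f‖² + ‖f'‖²)^{1/2}`. The pair is determined by
`f`. -/
def sobolev [CompleteSpace X] : Submodule ℂ (WithLp 2 (L2 X × L2 X)) where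
  carrier := {u | ∃ x, IsPrimitive x u.fst u.snd}
  add_mem' := by
    rintro u v ⟨x, hx⟩ ⟨y, hy⟩
    exact ⟨x + y, hx.add hy⟩
  zero_mem' := ⟨0, isPrimitive_zero⟩
  smul_mem' := by
    rintro c u ⟨x, hx⟩
    exact ⟨c • x, hx.smul c⟩

variable (X) in
/-- `W^{1,2}([-1,0], X)` as a normed space. -/
abbrev W12 [CompleteSpace X] : Type _ := ↥(sobolev X)

variable [CompleteSpace X]

/-- The inclusion `W^{1,2} → L²`, `f ↦ f`. -/
def W12.toL2 : W12 X →ₗ[ℂ] L2 X where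
  toFun u := u.1.fst
  map_add' _ _ := rfl
  map_smul' _ _ := rfl

/-- The derivative `W^{1,2} → L²`, `f ↦ f'`. -/
def W12.deriv : W12 X →ₗ[ℂ] L2 X where
  toFun u := u.1.snd
  map_add' _ _ := rfl
  map_smul' _ _ := rfl

/-- The point evaluation `W^{1,2} → X`, `f ↦ f(0)`. -/
noncomputable def W12.evalZero : W12 X →ₗ[ℂ] X where
  toFun u := u.2.choose
  map_add' u v := ((u + v).2.choose_spec.unique (u.2.choose_spec.add v.2.choose_spec)).1
  map_smul' c u := ((c • u).2.choose_spec.unique (u.2.choose_spec.smul c)).1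

theorem W12.toL2_injective : Function.Injective (W12.toL2 : W12 X →ₗ[ℂ] L2 X) := by
  intro u v huv
  obtain ⟨x, hx⟩ := u.2
  obtain ⟨y, hy⟩ := v.2
  have h1 : u.1.fst = v.1.fst := huv
  rw [← h1] at hy
  have h2 := (hx.unique hy).2
  apply Subtype.ext
  exact WithLp.ofLp_injective 2 (Prod.ext h1 h2)

/-- An `L²`-function that lies in `W^{1,2}`, regarded as an element of `W^{1,2}`. -/
noncomputable def W12.ofL2 : LinearMap.range (W12.toL2 : W12 X →ₗ[ℂ] L2 X) ≃ₗ[ℂ] W12 X :=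
  (LinearEquiv.ofInjective W12.toL2 W12.toL2_injective).symm

/-! ### The functions `e^{z·} x` -/

theorem norm_exp_smul_le (z : ℂ) (x : X) {t : ℝ} (ht : t ∈ Icc (-1 : ℝ) 0) :
    ‖Complex.exp (z * t) • x‖ ≤ Real.exp ‖z‖ * ‖x‖ := by
  rw [norm_smul]
  gcongr
  refine (Complex.norm_exp_le_exp_norm _).trans (Real.exp_le_exp.2 ?_)
  rw [norm_mul, Complex.norm_real, Real.norm_eq_abs, abs_of_nonpos ht.2]
  nlinarith [norm_nonneg z, ht.1]

theorem memLp_exp_smul (z : ℂ) (x : X) :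
    MemLp (fun t : ℝ => Complex.exp (z * t) • x) 2 histMeasure := by
  refine MemLp.of_bound (C := Real.exp ‖z‖ * ‖x‖) ?_ ?_
  · exact (by fun_prop : Continuous fun t : ℝ => Complex.exp (z * t) • x).aestronglyMeasurable
  · filter_upwards [ae_restrict_mem measurableSet_Icc] with t ht using norm_exp_smul_le z x ht

/-- The operator `X → L²`, `x ↦ e^{z·} x`. -/
noncomputable def expL2 (z : ℂ) : X →L[ℂ] L2 X :=
  LinearMap.mkContinuous
    { toFun := fun x => (memLp_exp_smul z x).toLp _
      map_add' := fun x y => by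
        rw [← MemLp.toLp_add]
        congr 1
        ext t
        simp
      map_smul' := fun c x => by
        rw [RingHom.id_apply, ← MemLp.toLp_const_smul]
        congr 1
        ext t
        simp [smul_comm c] }
    ((measureUnivNNReal histMeasure : ℝ) ^ (2 : ℝ≥0∞).toReal⁻¹ * Real.exp ‖z‖) (by
      intro x
      rw [mul_assoc]
      refine Lp.norm_le_of_ae_bound (by positivity) ?_
      filter_upwards [MemLp.coeFn_toLp (memLp_exp_smul z x), ae_restrict_mem measurableSet_Icc]
        with t h1 ht
      refine (le_of_eq (congrArg norm h1)).trans (norm_exp_smul_le z x ht))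

theorem coeFn_expL2 (z : ℂ) (x : X) :
    expL2 z x =ᵐ[histMeasure] fun t : ℝ => Complex.exp (z * t) • x :=
  MemLp.coeFn_toLp (memLp_exp_smul z x)

theorem isPrimitive_exp (z : ℂ) (x : X) : IsPrimitive x (expL2 z x) (z • expL2 z x) := by
  filter_upwards [coeFn_expL2 z x, ae_restrict_mem measurableSet_Icc] with t h1 ht
  have h2 : (z • expL2 z x : L2 X) =ᵐ[histMeasure]
      fun t : ℝ => z • (Complex.exp (z * t) • x) := by
    filter_upwards [Lp.coeFn_smul z (expL2 z x), coeFn_expL2 z x] with s h3 h4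
    rw [h3, Pi.smul_apply, h4]
  rw [h1, integral_congr_L2 h2 ht,
    intervalIntegral.integral_eq_sub_of_hasDerivAt (f := fun t : ℝ => Complex.exp (z * t) • x)]
  · simp
  · intro s _
    have h5 : HasDerivAt (fun t : ℝ => Complex.exp (z * t)) (Complex.exp (z * s) * (z * 1)) s :=
      ((Complex.ofRealCLM.hasDerivAt (x := s)).const_mul z).cexp
    have := h5.smul_const x
    rwa [mul_one, mul_comm, mul_smul] at this
  · exact (by fun_prop : Continuous fun t : ℝ => z • (Complex.exp (z * t) • x)).intervalIntegrable _ _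

/-- The operator `X → W^{1,2}`, `x ↦ e^{z·} x`. -/
noncomputable def expW12 (z : ℂ) : X →L[ℂ] W12 X :=
  ((WithLp.prodContinuousLinearEquiv 2 ℂ (L2 X) (L2 X)).symm.toContinuousLinearMap.comp
    ((expL2 z).prod (z • expL2 z))).codRestrict (sobolev X) fun x => by
      refine ⟨x, ?_⟩
      change IsPrimitive x (expL2 z x) ((z • expL2 z : X →L[ℂ] L2 X) x)
      rw [smul_apply]
      exact isPrimitive_exp z x

/-! ### The delay operator matrix -/

/-- `Φ_z ∈ 𝓛(X)`, `Φ_z x = Φ(e^{z·} x)`. -/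
noncomputable def delayAt (Φ : W12 X →L[ℂ] X) (z : ℂ) : X →L[ℂ] X := Φ.comp (expW12 z)

/-- The state space `X × L²([-1,0], X)` with the Hilbert space norm. -/
abbrev StateSpace (X : Type*) [NormedAddCommGroup X] : Type _ := WithLp 2 (X × L2 X)

/-- The delay operator matrix `(x, f) ↦ (B x + Φ f, f')` with domain
`{(x, f) ∈ D(B) × W^{1,2} : f(0) = x}`. -/
noncomputable def delayMatrix (B : X →ₗ.[ℂ] X) (Φ : W12 X →L[ℂ] X) :
    StateSpace X →ₗ.[ℂ] StateSpace X where
  domain :=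
    { carrier := {v | v.fst ∈ B.domain ∧ ∃ u : W12 X, u.toL2 = v.snd ∧ u.evalZero = v.fst}
      add_mem' := by
        rintro v w ⟨hv, u, hu1, hu2⟩ ⟨hw, u', hu1', hu2'⟩
        exact ⟨B.domain.add_mem hv hw, u + u', by simp [hu1, hu1'], by simp [hu2, hu2']⟩
      zero_mem' := ⟨B.domain.zero_mem, 0, by simp, by simp⟩
      smul_mem' := by
        rintro c v ⟨hv, u, hu1, hu2⟩
        exact ⟨B.domain.smul_mem c hv, c • u, by simp [hu1], by simp [hu2]⟩ }
  toFun :=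
    { toFun := fun v =>
        let f : W12 X := W12.ofL2 ⟨v.1.snd, v.2.2.choose, v.2.2.choose_spec.1⟩
        WithLp.toLp 2 (B ⟨v.1.fst, v.2.1⟩ + Φ f, f.deriv)
      map_add' := fun v w => by
        have hB := B.map_add ⟨v.1.fst, v.2.1⟩ ⟨w.1.fst, w.2.1⟩
        have hf := W12.ofL2.map_add ⟨v.1.snd, v.2.2.choose, v.2.2.choose_spec.1⟩
          ⟨w.1.snd, w.2.2.choose, w.2.2.choose_spec.1⟩
        refine WithLp.ofLp_injective 2 (Prod.ext ?_ ?_)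
        · refine (congrArg₂ (· + ·) hB ((congrArg Φ hf).trans (map_add Φ _ _))).trans ?_
          exact add_add_add_comm _ _ _ _
        · exact (congrArg W12.deriv hf).trans (map_add W12.deriv _ _)
      map_smul' := fun c v => by
        have hB := B.map_smul c ⟨v.1.fst, v.2.1⟩
        have hf := W12.ofL2.map_smul c ⟨v.1.snd, v.2.2.choose, v.2.2.choose_spec.1⟩
        refine WithLp.ofLp_injective 2 (Prod.ext ?_ ?_)
        · refine (congrArg₂ (· + ·) hB ((congrArg Φ hf).trans (map_smul Φ _ _))).trans ?_
          exact (smul_add c _ _).symm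
        · exact (congrArg W12.deriv hf).trans (map_smul W12.deriv _ _) }

/-- The generator `A₀` of the nilpotent left shift semigroup on `L²([-1,0], X)`: `A₀ f = f'` with
domain `{f ∈ W^{1,2} : f(0) = 0}`. -/
noncomputable def shiftGenerator (X : Type*) [NormedAddCommGroup X] [InnerProductSpace ℂ X]
    [CompleteSpace X] : L2 X →ₗ.[ℂ] L2 X where
  domain := (LinearMap.ker (W12.evalZero : W12 X →ₗ[ℂ] X)).map W12.toL2
  toFun := W12.deriv ∘ₗ W12.ofL2.toLinearMap ∘ₗ Submodule.inclusion LinearMap.map_le_range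

/-- The operator `Φ R(z, A₀) : L²([-1,0], X) → X`. -/
noncomputable def delayResolvent (Φ : W12 X →L[ℂ] X) (z : ℂ) : L2 X →ₗ[ℂ] X :=
  Φ.toLinearMap ∘ₗ W12.ofL2.toLinearMap ∘ₗ
    (resolventOp (shiftGenerator X) z).toLinearMap.codRestrict
      (LinearMap.range (W12.toL2 : W12 X →ₗ[ℂ] L2 X))
      fun h => LinearMap.map_le_range (resolventOp_mem_domain (shiftGenerator X) z h)

/-- Admissible delay operators: the delay operator matrix is a generator for each generator `B`, and
`z ↦ Φ R(z, A₀)` is a bounded analytic function, with values in `𝓛(L²([-1,0], X), X)`, on each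
half-plane `Re z > ω`. -/
def IsAdmissible (Φ : W12 X →L[ℂ] X) : Prop :=
  (∀ B : X →ₗ.[ℂ] X, GeneratesC0Semigroup B → GeneratesC0Semigroup (delayMatrix B Φ)) ∧
  ∃ F : ℂ → L2 X →L[ℂ] X, (∀ z, (F z).toLinearMap = delayResolvent Φ z) ∧
    ∀ ω : ℝ, AnalyticOnNhd ℂ F {z | ω < z.re} ∧ ∃ C : ℝ, ∀ z : ℂ, ω < z.re → ‖F z‖ ≤ C

end Sobolev

end DelayEq

namespace DelayEq

/-! ### Fourier transform of square integrable Hilbert-space valued functions -/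

section FourierPair

open FourierTransform SchwartzMap

/-! The state space is a Hilbert space, so Gearhart's criterion applies: a semigroup is hyperbolic
once its generator has a uniformly bounded resolvent on the imaginary axis. Admissibility makes the
delay matrix a generator, so only its resolvent at z = iω has to be bounded. Solving (z - 𝒜)(y, u) =
(x, f) by variation of constants gives u = e^{z·}y + R(z,A₀)f, and then y = R(z,B) N (x + Φ R(z,A₀)
f) with N = (1 - Φ_z R(z,B))⁻¹ (`exists_isResolventAt_delayMatrix`). Each factor is uniformly
bounded on the axis: N by the Neumann series, with bound ∑ aₙ; Φ R(z,A₀) by admissibility; R(z,A₀)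
and x ↦ e^{z·}x by 1; and R(z,B) by hyperbolicity of the semigroup of B, through R(z,B) = (1 -
e^{-z}S(1))⁻¹ ∫₀¹ e^{-zr} S(r) dr (`IsHyperbolic.exists_resolvent_bounded`).

Gearhart's criterion (`isHyperbolic_of_resolvent_bounded`) rests on Plancherel. Far to the right the
resolvent along a vertical line is the Fourier transform of a damped orbit, hence square integrable;
the resolvent identity and the uniform bound carry this to the imaginary axis. The inverse Fourier
transform U of s ↦ R(2πis)x then satisfies an inhomogeneous recurrence under t ↦ t + 1, and sampling
U along a suitable coset of ℤ gives an ℓ²(ℤ) solution of w(n+1) = T(1)w(n) + δ_{n,0} T(1)x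
(`exists_discrete_solution`). Such solutions are unique, because the Fourier transform of a square
integrable complete orbit would consist of eigenvectors with imaginary eigenvalues
(`eq_zero_of_discrete_orbit`).

Unique ℓ² solvability splits the space into vectors with ℓ² forward orbits and vectors with ℓ²
backward orbits, with uniform bounds. Averaging these bounds along an orbit shows that a high power
of T(1) contracts the first space and expands the second by a factor 2, which gives exponential
rates (`HasDiscreteDichotomy.isHyperbolic`). -/

theorem hasTemperateGrowth_cexp_mul_I (h : ℝ) :
    (fun s : ℝ => Complex.exp (2 * Real.pi * h * Complex.I * s)).HasTemperateGrowth := by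
  refine ⟨(contDiff_const.mul Complex.ofRealCLM.contDiff).cexp, fun n => ⟨0, ‖(2 * Real.pi * h * Complex.I : ℂ)‖ ^ n, fun x => ?_⟩⟩
  have key : ∀ n : ℕ, iteratedDeriv n
      (fun s : ℝ => Complex.exp (2 * Real.pi * h * Complex.I * s)) =
      fun s : ℝ => (2 * Real.pi * h * Complex.I : ℂ) ^ n *
        Complex.exp (2 * Real.pi * h * Complex.I * s) := by
    intro n
    induction n with
    | zero => simp
    | succ n ih =>
      rw [iteratedDeriv_succ, ih]
      ext s
      have : HasDerivAt (fun s : ℝ => Complex.exp (2 * Real.pi * h * Complex.I * s))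
          (Complex.exp (2 * Real.pi * h * Complex.I * s) * (2 * Real.pi * h * Complex.I * 1)) s :=
        ((Complex.ofRealCLM.hasDerivAt (x := s)).const_mul _).cexp
      rw [(this.const_mul _).deriv]
      ring
  rw [norm_iteratedFDeriv_eq_norm_iteratedDeriv, key, norm_mul, norm_pow]
  have : ‖Complex.exp (2 * Real.pi * h * Complex.I * x)‖ = 1 := by
    rw [show (2 * Real.pi * h * Complex.I * x : ℂ) = ((2 * Real.pi * h * x : ℝ) : ℂ) * Complex.I by
      push_cast; ring, Complex.norm_exp_ofReal_mul_I]
  rw [this]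
  simp

variable {H : Type*} [NormedAddCommGroup H] [InnerProductSpace ℂ H]

/-- `V` is the Fourier transform of `U`, where both are square integrable functions on the line. -/
structure IsFourierPair (U V : ℝ → H) : Prop where
  memLp_left : MemLp U 2
  memLp_right : MemLp V 2
  integral_eq : ∀ φ : 𝓢(ℝ, ℂ), ∫ t, 𝓕 φ t • U t = ∫ s, φ s • V s

/-- This is injectivity of the embedding of L² into tempered distributions. Both uniqueness
statements for Fourier pairs reduce to it. -/
theorem ae_eq_of_integral_schwartz_smul_eq [CompleteSpace H] {f g : ℝ → H} (hf : MemLp f 2)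
    (hg : MemLp g 2) (h : ∀ φ : 𝓢(ℝ, ℂ), ∫ t, φ t • f t = ∫ t, φ t • g t) : f =ᵐ[volume] g := by
  have hker := Lp.ker_toTemperedDistributionCLM_eq_bot (F := H) (μ := (volume : Measure ℝ)) (p := 2)
  rw [LinearMap.ker_eq_bot] at hker
  have : hf.toLp f = hg.toLp g := by
    apply hker
    ext φ
    simp only [ContinuousLinearMap.coe_coe, Lp.toTemperedDistributionCLM_apply,
      Lp.toTemperedDistribution_apply]
    have h1 : ∫ t, φ t • (hf.toLp f) t = ∫ t, φ t • f t := by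
      apply integral_congr_ae
      filter_upwards [hf.coeFn_toLp] with t ht using by rw [ht]
    have h2 : ∫ t, φ t • (hg.toLp g) t = ∫ t, φ t • g t := by
      apply integral_congr_ae
      filter_upwards [hg.coeFn_toLp] with t ht using by rw [ht]
    rw [h1, h2, h]
  exact (MemLp.toLp_eq_toLp_iff hf hg).1 this

theorem integrable_schwartz_smul {f : ℝ → H} (hf : MemLp f 2) (φ : 𝓢(ℝ, ℂ)) :
    Integrable fun t => φ t • f t := by
  have := hf.smul (φ.memLp 2) (r := 1)
  exact memLp_one_iff_integrable.1 this

namespace IsFourierPair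

variable {U V U' V' : ℝ → H}

theorem congr_right (h : IsFourierPair U V) (h' : V =ᵐ[volume] V') : IsFourierPair U V' :=
  ⟨h.1, (memLp_congr_ae h').1 h.2, fun φ => by
    rw [h.3]; apply integral_congr_ae; filter_upwards [h'] with t ht using by rw [ht]⟩

theorem congr_left (h : IsFourierPair U V) (h' : U =ᵐ[volume] U') : IsFourierPair U' V :=
  ⟨(memLp_congr_ae h').1 h.1, h.2, fun φ => by
    rw [← h.3]; apply integral_congr_ae; filter_upwards [h'] with t ht using by rw [ht]⟩

theorem sub (h : IsFourierPair U V) (h' : IsFourierPair U' V') :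
    IsFourierPair (U - U') (V - V') := by
  refine ⟨h.1.sub h'.1, h.2.sub h'.2, fun φ => ?_⟩
  simp only [Pi.sub_apply, smul_sub]
  rw [integral_sub (integrable_schwartz_smul h.1 _) (integrable_schwartz_smul h'.1 _),
    integral_sub (integrable_schwartz_smul h.2 _) (integrable_schwartz_smul h'.2 _), h.3, h'.3]

theorem comp_clm [CompleteSpace H] (h : IsFourierPair U V) (S : H →L[ℂ] H) :
    IsFourierPair (fun t => S (U t)) (fun s => S (V s)) := by
  refine ⟨S.comp_memLp' h.1, S.comp_memLp' h.2, fun φ => ?_⟩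
  simp only [← map_smul]
  rw [S.integral_comp_comm (integrable_schwartz_smul h.1 _),
    S.integral_comp_comm (integrable_schwartz_smul h.2 _), h.3]

/-- The modulation is moved onto the test function: multiplying φ by e^{2πias} translates 𝓕 φ by a,
and a change of variables transfers that translation to U. The modulated φ is again Schwartz because
the exponential has temperate growth. -/
theorem translate (h : IsFourierPair U V) (a : ℝ) :
    IsFourierPair (fun t => U (t + a))
      (fun s => Complex.exp (2 * Real.pi * a * Complex.I * s) • V s) := by
  refine ⟨h.1.comp_measurePreserving (measurePreserving_add_right volume a), ?_, fun φ => ?_⟩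
  · refine h.2.of_le ?_ (Eventually.of_forall fun s => ?_)
    · exact (by fun_prop : Continuous fun s : ℝ =>
        Complex.exp (2 * Real.pi * a * Complex.I * s)).aestronglyMeasurable.smul h.2.1
    · rw [norm_smul, show (2 * Real.pi * a * Complex.I * s : ℂ)
        = ((2 * Real.pi * a * s : ℝ) : ℂ) * Complex.I by push_cast; ring,
        Complex.norm_exp_ofReal_mul_I, one_mul]
  · have hg := hasTemperateGrowth_cexp_mul_I a
    set ψ := smulLeftCLM ℂ (fun s : ℝ => Complex.exp (2 * Real.pi * a * Complex.I * s)) φ with hψ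
    have h1 : ∀ t, 𝓕 ψ t = 𝓕 φ (t - a) := by
      intro t
      rw [fourier_coe, fourier_coe, Real.fourier_real_eq_integral_exp_smul,
        Real.fourier_real_eq_integral_exp_smul]
      congr 1
      ext s
      rw [hψ, smulLeftCLM_apply_apply hg, smul_smul, ← Complex.exp_add]
      congr 2
      push_cast
      ring
    have h2 : ∫ t, 𝓕 ψ t • U t = ∫ s, ψ s • V s := h.3 ψ
    have h3 : ∫ t, 𝓕 φ t • U (t + a) = ∫ t, 𝓕 ψ t • U t := by
      rw [← integral_add_right_eq_self (fun t => 𝓕 ψ t • U t) a]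
      simp [h1]
    rw [h3, h2]
    congr 1
    ext s
    rw [hψ, smulLeftCLM_apply_apply hg, smul_smul, smul_eq_mul, mul_comm]

variable [CompleteSpace H]

theorem left_unique (h : IsFourierPair U V) (h' : IsFourierPair U' V) : U =ᵐ[volume] U' := by
  refine ae_eq_of_integral_schwartz_smul_eq h.1 h'.1 fun φ => ?_
  have h1 := h.3 (𝓕⁻ φ)
  have h2 := h'.3 (𝓕⁻ φ)
  rw [FourierTransform.fourier_fourierInv_eq] at h1 h2
  rw [h1, h2]

theorem right_unique (h : IsFourierPair U V) (h' : IsFourierPair U V') : V =ᵐ[volume] V' :=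
  ae_eq_of_integral_schwartz_smul_eq h.2 h'.2 fun φ => by rw [← h.3, ← h'.3]

end IsFourierPair

variable [CompleteSpace H]

theorem isFourierPair_fourier_Lp (f : Lp (α := ℝ) H 2) : IsFourierPair f (𝓕 f : Lp (α := ℝ) H 2) := by
  refine ⟨Lp.memLp _, Lp.memLp _, fun φ => ?_⟩
  have := congrArg (fun T : TemperedDistribution ℝ H => T φ) (Lp.fourier_toTemperedDistribution_eq f)
  simpa [Lp.toTemperedDistribution_apply, TemperedDistribution.fourier_apply] using this

theorem exists_isFourierPair_right {U : ℝ → H} (hU : MemLp U 2) : ∃ V, IsFourierPair U V :=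
  ⟨_, (isFourierPair_fourier_Lp (hU.toLp U)).congr_left hU.coeFn_toLp⟩

theorem exists_isFourierPair_left {V : ℝ → H} (hV : MemLp V 2) : ∃ U, IsFourierPair U V := by
  have := isFourierPair_fourier_Lp (𝓕⁻ (hV.toLp V))
  rw [FourierTransform.fourier_fourierInv_eq] at this
  exact ⟨_, this.congr_right hV.coeFn_toLp⟩

theorem IsFourierPair.eLpNorm_eq {U V : ℝ → H} (h : IsFourierPair U V) :
    eLpNorm V 2 = eLpNorm U 2 := by
  have h1 := (isFourierPair_fourier_Lp (h.1.toLp U)).congr_left h.1.coeFn_toLp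
  rw [eLpNorm_congr_ae (h.right_unique h1), ← Lp.enorm_def, ← eLpNorm_congr_ae h.1.coeFn_toLp,
    ← Lp.enorm_def, ← ofReal_norm, Lp.norm_fourier_eq, ofReal_norm]

/-- The L² partner V and the integral transform 𝓕 g have the same pairing with test functions, by
the Fubini identity ∫ 𝓕φ g = ∫ φ 𝓕g. Only compactly supported tests are used, since beforehand 𝓕 g
is known merely to be continuous, not square integrable. -/
theorem isFourierPair_of_integrable {g : ℝ → H} (h1 : Integrable g) (h2 : MemLp g 2) :
    IsFourierPair g (𝓕 g) := by
  obtain ⟨V, hV⟩ := exists_isFourierPair_right h2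
  refine hV.congr_right ?_
  have hcont : Continuous (𝓕 g) := VectorFourier.fourierIntegral_continuous
    Real.continuous_fourierChar continuous_inner h1
  have hflip (φ : 𝓢(ℝ, ℂ)) : ∫ t, 𝓕 φ t • g t = ∫ s, φ s • 𝓕 g s := by
    simpa [fourier_coe] using! VectorFourier.integral_fourierIntegral_smul_eq_flip
      (L := innerₗ ℝ) Real.continuous_fourierChar continuous_inner φ.integrable h1
  have := ae_eq_zero_of_integral_contDiff_smul_eq_zero (μ := volume) (f := fun s => V s - 𝓕 g s)
    ((hV.2.locallyIntegrable (by norm_num)).sub hcont.locallyIntegrable) ?_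
  · filter_upwards [this] with s hs using sub_eq_zero.1 hs
  · intro φ hφ hc
    have hg₁ : HasCompactSupport (Complex.ofRealCLM ∘ φ) := hc.comp_left rfl
    have hg₂ : ContDiff ℝ (⊤ : ℕ∞) (Complex.ofRealCLM ∘ φ) := by fun_prop
    set ψ : 𝓢(ℝ, ℂ) := hg₁.toSchwartzMap hg₂ with hψ
    have h3 : ∀ s, φ s • (V s - 𝓕 g s) = ψ s • V s - ψ s • 𝓕 g s := by
      intro s
      rw [← smul_sub]
      simp [hψ]
    simp only [h3]
    rw [integral_sub (integrable_schwartz_smul hV.2 _), ← hflip, hV.3, sub_self]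
    have hψc : HasCompactSupport fun s => ψ s • 𝓕 g s := by
      refine HasCompactSupport.smul_right (f := fun s => ψ s) ?_
      exact hg₁
    exact (ψ.continuous.smul hcont).integrable_of_hasCompactSupport hψc

end FourierPair

/-! ### Growth bounds, generators and Laplace integrals of semigroups -/

section SemigroupBasics

variable {E : Type*} [NormedAddCommGroup E] [NormedSpace ℂ E]

namespace C0Semigroup

variable (T : C0Semigroup E)

theorem op_add_apply (s t : ℝ≥0) (x : E) : T.op (s + t) x = T.op s (T.op t x) := by
  rw [T.op_add]; rfl

theorem op_zero_apply (x : E) : T.op 0 x = x := by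
  rw [T.op_zero]; rfl

theorem op_comm (s t : ℝ≥0) (x : E) : T.op s (T.op t x) = T.op t (T.op s x) := by
  rw [← op_add_apply, add_comm, op_add_apply]

theorem op_nat (n : ℕ) : T.op n = T.op 1 ^ n := by
  induction n with
  | zero => simp [T.op_zero]; rfl
  | succ n ih => rw [Nat.cast_succ, T.op_add, ih, pow_succ]; rfl

theorem continuous_orbit_real (x : E) : Continuous fun t : ℝ => T.op t.toNNReal x :=
  (T.continuous_orbit x).comp continuous_real_toNNReal

theorem exists_norm_op_le_of_le [CompleteSpace E] (a : ℝ≥0) :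
    ∃ M : ℝ, 1 ≤ M ∧ ∀ t ≤ a, ‖T.op t‖ ≤ M := by
  obtain ⟨M, hM⟩ := banach_steinhaus (g := fun t : Icc (0 : ℝ≥0) a => T.op t) fun x => by
    obtain ⟨C, hC⟩ := (isCompact_Icc (a := (0 : ℝ≥0)) (b := a)).exists_bound_of_continuousOn
      (T.continuous_orbit x).continuousOn
    exact ⟨C, fun t => hC t t.2⟩
  exact ⟨max M 1, le_max_right _ _, fun t ht => (hM ⟨t, zero_le, ht⟩).trans (le_max_left _ _)⟩

theorem exists_norm_op_le_exp [CompleteSpace E] :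
    ∃ M ω : ℝ, 1 ≤ M ∧ 0 < ω ∧ ∀ t : ℝ≥0, ‖T.op t‖ ≤ M * Real.exp (ω * t) := by
  obtain ⟨M, hM1, hM⟩ := T.exists_norm_op_le_of_le 1
  have hM0 : 0 < M := by linarith
  -- The rate log M already suffices for the estimate; the extra 1 makes it strictly positive when M
  -- = 1.
  refine ⟨M, Real.log M + 1, hM1, by linarith [Real.log_nonneg hM1], fun t => ?_⟩
  obtain ⟨n, s, hs, rfl⟩ : ∃ (n : ℕ) (s : ℝ≥0), s ≤ 1 ∧ t = n + s :=
    ⟨⌊t⌋₊, t - ⌊t⌋₊, tsub_le_iff_left.2 (Nat.lt_floor_add_one t).le,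
      (add_tsub_cancel_of_le (Nat.floor_le zero_le)).symm⟩
  rw [T.op_add, T.op_nat]
  calc ‖(T.op 1 ^ n).comp (T.op s)‖ ≤ ‖T.op 1 ^ n‖ * ‖T.op s‖ :=
        ContinuousLinearMap.opNorm_comp_le _ _
    _ ≤ M ^ n * M := by
        gcongr
        · cases n with
          | zero => rw [pow_zero, pow_zero]; exact ContinuousLinearMap.norm_id_le
          | succ n =>
            exact (norm_pow_le' _ n.succ_pos).trans (pow_le_pow_left₀ (norm_nonneg _) (hM 1 le_rfl) _)
        · exact hM s hs
    _ = M * Real.exp (Real.log M * n) := by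
        rw [mul_comm, mul_comm (Real.log M), Real.exp_nat_mul, Real.exp_log hM0]
    _ ≤ M * Real.exp ((Real.log M + 1) * ((n + s : ℝ≥0) : ℝ)) := by
        gcongr
        · linarith [Real.log_nonneg hM1]
        · linarith
        · push_cast; linarith [s.2]

variable {T} {A : E →ₗ.[ℂ] E}

theorem IsGenerator.op_mem_graph (hA : T.IsGenerator A) {x y : E} (h : (x, y) ∈ A.graph)
    (s : ℝ≥0) : (T.op s x, T.op s y) ∈ A.graph := by
  rw [hA] at h ⊢
  refine (((T.op s).continuous.tendsto _).comp h).congr fun t => ?_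
  simp only [Function.comp_apply]
  rw [ContinuousLinearMap.map_smul_of_tower, map_sub, T.op_comm]

/-- Lets membership in the generator's graph be checked by ordinary two-sided calculus, when the
orbit is given by a formula that makes sense for negative times too. -/
theorem IsGenerator.graph_of_hasDerivAt (hA : T.IsGenerator A) {x y : E} {f : ℝ → E}
    (hf : ∀ t : ℝ≥0, T.op t x = f t) (hd : HasDerivAt f y 0) : (x, y) ∈ A.graph := by
  rw [hA]
  have h1 := hasDerivAt_iff_tendsto_slope_zero.1 hd
  have h2 : Tendsto (fun t : ℝ≥0 => (t : ℝ)) (𝓝[>] 0) (𝓝[≠] 0) := by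
    refine tendsto_nhdsWithin_of_tendsto_nhds_of_eventually_within _ ?_ ?_
    · exact (NNReal.continuous_coe.tendsto' 0 0 rfl).mono_left nhdsWithin_le_nhds
    · filter_upwards [self_mem_nhdsWithin] with t ht
      exact NNReal.coe_ne_zero.2 (ne_of_gt ht)
  refine (h1.comp h2).congr fun t => ?_
  have h0 := hf 0
  rw [T.op_zero_apply] at h0
  simp only [Function.comp_apply, zero_add]
  rw [← hf, h0]
  rfl

/-- The definition of the generator yields right derivatives directly, and these are all that the
fundamental theorem of calculus used below requires. -/
theorem IsGenerator.hasDerivWithinAt (hA : T.IsGenerator A) {x y : E} (h : (x, y) ∈ A.graph)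
    {r : ℝ} (hr : 0 ≤ r) :
    HasDerivWithinAt (fun r : ℝ => T.op r.toNNReal x) (T.op r.toNNReal y) (Ioi r) r := by
  have h0 := (hA _ _).1 (hA.op_mem_graph h r.toNNReal)
  rw [hasDerivWithinAt_iff_tendsto_slope' (by simp)]
  have h2 : Tendsto (fun s : ℝ => (s - r).toNNReal) (𝓝[>] r) (𝓝[>] 0) := by
    refine tendsto_nhdsWithin_of_tendsto_nhds_of_eventually_within _ ?_ ?_
    · exact ((by fun_prop : Continuous fun s : ℝ => (s - r).toNNReal).tendsto' r 0
        (by simp)).mono_left nhdsWithin_le_nhds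
    · filter_upwards [self_mem_nhdsWithin] with t ht
      simpa using ht
  refine (h0.comp h2).congr' ?_
  filter_upwards [self_mem_nhdsWithin] with s hs
  have hs' : 0 ≤ s - r := (sub_pos.2 hs).le
  simp only [Function.comp_apply, slope_def_module]
  rw [← T.op_add_apply, ← Real.toNNReal_add hs' hr, sub_add_cancel, Real.coe_toNNReal _ hs']

theorem continuous_exp_smul_orbit (T : C0Semigroup E) (z : ℂ) (x : E) :
    Continuous fun r : ℝ => Complex.exp (-z * r) • T.op r.toNNReal x :=
  (by fun_prop : Continuous fun r : ℝ => Complex.exp (-z * r)).smul (T.continuous_orbit_real x)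

theorem hasDerivAt_exp_neg_mul (z : ℂ) (r : ℝ) :
    HasDerivAt (fun r : ℝ => Complex.exp (-z * r)) (-z * Complex.exp (-z * r)) r := by
  have := ((Complex.ofRealCLM.hasDerivAt (x := r)).const_mul (-z)).cexp
  simpa [mul_comm] using this

/-- If `A y = z y - x` then `y - e^{-z a} T(a) y = ∫_0^a e^{-z r} T(r) x dr`. -/
theorem IsGenerator.sub_exp_smul_op_eq [CompleteSpace E] (hA : T.IsGenerator A) {x y : E} {z : ℂ}
    (h : (y, z • y - x) ∈ A.graph) {a : ℝ} (ha : 0 ≤ a) :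
    y - Complex.exp (-z * a) • T.op a.toNNReal y =
      ∫ r in (0 : ℝ)..a, Complex.exp (-z * r) • T.op r.toNNReal x := by
  have hd : ∀ r ∈ Ioo (min 0 a) (max 0 a),
      HasDerivWithinAt (fun r : ℝ => Complex.exp (-z * r) • T.op r.toNNReal y)
        (-(Complex.exp (-z * r) • T.op r.toNNReal x)) (Ioi r) r := by
    intro r hr
    rw [min_eq_left ha] at hr
    have := (hasDerivAt_exp_neg_mul z r).hasDerivWithinAt (s := Ioi r) |>.smul
      (hA.hasDerivWithinAt h hr.1.le)
    convert! this using 1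
    rw [map_sub, map_smul]
    module
  have := intervalIntegral.integral_eq_sub_of_hasDeriv_right
    (T.continuous_exp_smul_orbit z y).continuousOn hd
    ((T.continuous_exp_smul_orbit z x).neg.intervalIntegrable _ _)
  rw [intervalIntegral.integral_neg] at this
  rw [← neg_inj, this]
  simp [T.op_zero_apply]

theorem exp_smul_op_add (T : C0Semigroup E) (z : ℂ) (x : E) (h : ℝ≥0) {r : ℝ} (hr : 0 ≤ r) :
    T.op h (Complex.exp (-z * r) • T.op r.toNNReal x) =
      Complex.exp (z * h) • (Complex.exp (-z * (r + h : ℝ)) • T.op (r + h).toNNReal x) := by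
  rw [map_smul, ← T.op_add_apply, smul_smul, ← Complex.exp_add,
    show (r + h : ℝ).toNNReal = h + r.toNNReal by
      rw [Real.toNNReal_add hr h.coe_nonneg, Real.toNNReal_coe, add_comm]]
  congr 2
  push_cast
  ring

theorem hasDerivAt_exp_smul_of (z : ℂ) {f : ℝ → E} {y : E} (hf : HasDerivAt f y 0) :
    HasDerivAt (fun h : ℝ => Complex.exp (z * h) • f h) (z • f 0 + y) 0 := by
  have h1 := hasDerivAt_exp_neg_mul (-z) 0
  simp only [neg_neg, Complex.ofReal_zero, mul_zero, Complex.exp_zero, mul_one] at h1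
  have := h1.smul hf
  convert! this using 1
  simp [add_comm]

/-- The truncated Laplace integral lies in the domain of the generator. -/
theorem IsGenerator.integral_mem_graph [CompleteSpace E] (hA : T.IsGenerator A) (x : E) (z : ℂ)
    {a : ℝ} (ha : 0 ≤ a) :
    (∫ r in (0 : ℝ)..a, Complex.exp (-z * r) • T.op r.toNNReal x,
      z • (∫ r in (0 : ℝ)..a, Complex.exp (-z * r) • T.op r.toNNReal x) -
        (x - Complex.exp (-z * a) • T.op a.toNNReal x)) ∈ A.graph := by
  set g : ℝ → E := fun r => Complex.exp (-z * r) • T.op r.toNNReal x with hg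
  have hgc : Continuous g := T.continuous_exp_smul_orbit z x
  have hg0 : g 0 = x := by simp [hg, T.op_zero_apply]
  -- Applying T(h) shifts the window of integration to [h, a + h] at the cost of a factor e^{zh}, so
  -- the orbit is differentiable in h without any smoothness of x.
  refine hA.graph_of_hasDerivAt (f := fun h => Complex.exp (z * h) • ∫ r in h..(a + h), g r) ?_ ?_
  · intro h
    rw [← ContinuousLinearMap.intervalIntegral_comp_comm _ (hgc.intervalIntegrable _ _),
      ← intervalIntegral.integral_smul]
    have := intervalIntegral.integral_comp_add_right (a := 0) (b := a)
      (fun r => Complex.exp (z * h) • g r) (h : ℝ)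
    rw [zero_add] at this
    rw [← this]
    refine intervalIntegral.integral_congr fun r hr => ?_
    rw [uIcc_of_le ha] at hr
    exact T.exp_smul_op_add z x h hr.1
  · have h1 : HasDerivAt (fun h : ℝ => ∫ r in h..(a + h), g r) (g a - g 0) 0 := by
      have h2 : HasDerivAt (fun b : ℝ => ∫ r in (0 : ℝ)..b, g r) (g (a + 0)) (a + 0) :=
        hgc.integral_hasStrictDerivAt 0 (a + 0) |>.hasDerivAt
      have h3 : HasDerivAt (fun b : ℝ => ∫ r in (0 : ℝ)..b, g r) (g 0) 0 :=
        hgc.integral_hasStrictDerivAt 0 0 |>.hasDerivAt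
      have h4 := (h2.comp_const_add a 0).sub h3
      rw [add_zero] at h4
      refine h4.congr_of_eventuallyEq (Eventually.of_forall fun h => ?_)
      simp only [Pi.sub_apply]
      rw [intervalIntegral.integral_interval_sub_left (hgc.intervalIntegrable _ _)
        (hgc.intervalIntegrable _ _)]
    have h5 := hasDerivAt_exp_smul_of z h1
    convert! h5 using 1
    rw [hg0, add_zero]
    simp only [hg]
    abel

/-- The Laplace integral lies in the domain of the generator. -/
theorem IsGenerator.laplace_mem_graph [CompleteSpace E] (hA : T.IsGenerator A) (x : E) (z : ℂ)
    (hi : IntegrableOn (fun r : ℝ => Complex.exp (-z * r) • T.op r.toNNReal x) (Ioi 0)) :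
    (∫ r in Ioi (0 : ℝ), Complex.exp (-z * r) • T.op r.toNNReal x,
      z • (∫ r in Ioi (0 : ℝ), Complex.exp (-z * r) • T.op r.toNNReal x) - x) ∈ A.graph := by
  set g : ℝ → E := fun r => Complex.exp (-z * r) • T.op r.toNNReal x with hg
  have hgc : Continuous g := T.continuous_exp_smul_orbit z x
  have hg0 : g 0 = x := by simp [hg, T.op_zero_apply]
  refine hA.graph_of_hasDerivAt
    (f := fun h => Complex.exp (z * h) • ((∫ r in Ioi (0 : ℝ), g r) - ∫ r in (0 : ℝ)..h, g r)) ?_ ?_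
  · intro h
    rw [← ContinuousLinearMap.integral_comp_comm _ hi]
    have h1 : ∫ r in Ioi (0 : ℝ), T.op h (g r) =
        ∫ r in Ioi (0 : ℝ), Complex.exp (z * h) • g (r + h) :=
      setIntegral_congr_fun measurableSet_Ioi fun r hr => T.exp_smul_op_add z x h (le_of_lt hr)
    rw [h1, integral_smul]
    congr 1
    rw [← intervalIntegral.integral_interval_add_Ioi' (a := 0) (b := (h : ℝ))
      (hgc.intervalIntegrable _ _) (hi.mono_set (Ioi_subset_Ioi h.2)), add_sub_cancel_left]
    have := (measurePreserving_add_right volume (h : ℝ)).setIntegral_preimage_emb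
      (measurableEmbedding_addRight (h : ℝ)) g (Ioi (h : ℝ))
    simpa using this
  · have h3 : HasDerivAt (fun b : ℝ => (∫ r in Ioi (0 : ℝ), g r) - ∫ r in (0 : ℝ)..b, g r)
        (-g 0) 0 := by
      simpa using (hgc.integral_hasStrictDerivAt 0 0).hasDerivAt.const_sub _
    have h5 := hasDerivAt_exp_smul_of z h3
    convert! h5 using 1
    simp [hg0, sub_eq_add_neg]

end C0Semigroup

open C0Semigroup

variable {A : E →ₗ.[ℂ] E} {z : ℂ} {R : E →L[ℂ] E}

theorem IsResolventAt.mem_graph (hR : IsResolventAt A z R) (x : E) :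
    (R x, z • R x - x) ∈ A.graph := by
  obtain ⟨h, hx⟩ := hR.1 x
  rw [LinearPMap.mem_graph_iff]
  refine ⟨⟨R x, h⟩, rfl, ?_⟩
  change A ⟨R x, h⟩ = z • R x - x
  rw [eq_sub_iff_add_eq, add_comm, ← sub_eq_iff_eq_add.1 hx]

theorem IsResolventAt.eq_of_mem_graph (hR : IsResolventAt A z R) {x y : E} (h : (y, x) ∈ A.graph) :
    R (z • y - x) = y := by
  rw [LinearPMap.mem_graph_iff] at h
  obtain ⟨w, rfl, rfl⟩ := h
  exact hR.2 w

theorem isResolventAt_of_graph (h1 : ∀ x, (R x, z • R x - x) ∈ A.graph)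
    (h2 : ∀ x y, (y, x) ∈ A.graph → R (z • y - x) = y) : IsResolventAt A z R := by
  refine ⟨fun x => ?_, fun x => h2 _ _ (A.mem_graph x)⟩
  obtain ⟨w, hw, hw'⟩ := (LinearPMap.mem_graph_iff _).1 (h1 x)
  simp only at hw hw'
  have hm : R x ∈ A.domain := hw ▸ w.2
  refine ⟨hm, ?_⟩
  have : w = ⟨R x, hm⟩ := Subtype.ext hw
  rw [← this, hw']
  simp

theorem IsResolventAt.unique {R' : E →L[ℂ] E} (hR : IsResolventAt A z R)
    (hR' : IsResolventAt A z R') : R = R' := by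
  ext x
  have := hR.eq_of_mem_graph (hR'.mem_graph x)
  simpa using this

theorem IsResolventAt.resolventOp_eq (hR : IsResolventAt A z R) : resolventOp A z = R := by
  have h : ∃ R, IsResolventAt A z R := ⟨R, hR⟩
  unfold resolventOp
  rw [dif_pos h]
  exact h.choose_spec.unique hR

theorem IsResolventAt.op_comm {T : C0Semigroup E} (hA : T.IsGenerator A)
    (hR : IsResolventAt A z R) (t : ℝ≥0) (x : E) : T.op t (R x) = R (T.op t x) := by
  have := hR.eq_of_mem_graph (hA.op_mem_graph (hR.mem_graph x) t)
  rw [← this]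
  simp

end SemigroupBasics

/-! ### From unique ℓ²(ℤ) solvability to exponential dichotomy -/

section Dichotomy

variable {E : Type*} [NormedAddCommGroup E]

theorem summable_norm_sq_add {ι : Type*} {f g : ι → E} (hf : Summable fun n => ‖f n‖ ^ 2)
    (hg : Summable fun n => ‖g n‖ ^ 2) : Summable fun n => ‖f n + g n‖ ^ 2 := by
  refine Summable.of_nonneg_of_le (fun _ => by positivity) (fun n => ?_) ((hf.add hg).mul_left 2)
  have := norm_add_le (f n) (g n)
  nlinarith [norm_nonneg (f n + g n), sq_nonneg (‖f n‖ - ‖g n‖)]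

variable [NormedSpace ℂ E]

theorem summable_norm_sq_smul {ι : Type*} (c : ℂ) {f : ι → E} (hf : Summable fun n => ‖f n‖ ^ 2) :
    Summable fun n => ‖c • f n‖ ^ 2 := by
  simp only [norm_smul, mul_pow]
  exact hf.mul_left _

/-- The vectors with square summable forward orbit. -/
def stableSubspace (S : E →L[ℂ] E) : Submodule ℂ E where
  carrier := {x | Summable fun n : ℕ => ‖(S ^ n) x‖ ^ 2}
  add_mem' hx hy := by
    simp only [mem_ofPred_eq, map_add] at *
    exact summable_norm_sq_add hx hy
  zero_mem' := by simp [summable_zero]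
  smul_mem' c x hx := by
    simp only [mem_ofPred_eq, map_smul] at *
    exact summable_norm_sq_smul c hx

/-- `v` is a backward orbit of `x` under `S`, with `‖v ·‖²` summable. -/
structure IsBackwardOrbit (S : E →L[ℂ] E) (x : E) (v : ℕ → E) : Prop where
  zero : v 0 = x
  map_succ : ∀ n, S (v (n + 1)) = v n
  summable : Summable fun n => ‖v n‖ ^ 2

/-- The vectors with a square summable backward orbit. -/
def unstableSubspace (S : E →L[ℂ] E) : Submodule ℂ E where
  carrier := {x | ∃ v, IsBackwardOrbit S x v}
  add_mem' := by
    rintro x y ⟨v, hv⟩ ⟨w, hw⟩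
    exact ⟨v + w, by simp [hv.1, hw.1], fun n => by simp [hv.2, hw.2],
      summable_norm_sq_add hv.3 hw.3⟩
  zero_mem' := ⟨0, rfl, fun n => by simp, by simp [summable_zero]⟩
  smul_mem' := by
    rintro c x ⟨v, hv⟩
    exact ⟨c • v, by simp [hv.1], fun n => by simp [hv.2], summable_norm_sq_smul c hv.3⟩

variable {S : E →L[ℂ] E} {x : E}

theorem IsBackwardOrbit.pow_apply {v : ℕ → E} (hv : IsBackwardOrbit S x v) (k n : ℕ) :
    (S ^ k) (v (n + k)) = v n := by
  induction k with
  | zero => simp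
  | succ k ih => rw [pow_succ, mul_apply_eq_comp, ← add_assoc, hv.2, ih]

theorem IsBackwardOrbit.mem {v : ℕ → E} (hv : IsBackwardOrbit S x v) (n : ℕ) :
    v n ∈ unstableSubspace S :=
  ⟨fun k => v (k + n), by simp, fun k => by rw [add_right_comm, hv.2],
    (summable_nat_add_iff (f := fun k => ‖v k‖ ^ 2) n).2 hv.3⟩

theorem pow_mem_stableSubspace (hx : x ∈ stableSubspace S) (n : ℕ) :
    (S ^ n) x ∈ stableSubspace S := by
  have := (summable_nat_add_iff (f := fun k => ‖(S ^ k) x‖ ^ 2) n).2 hx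
  change Summable fun k : ℕ => ‖(S ^ k) ((S ^ n) x)‖ ^ 2
  simpa only [pow_add, mul_apply_eq_comp] using this

variable (S) in
/-- Unique solvability of `w (n + 1) = S (w n) + δ_{n, 0} S x` in `ℓ²(ℤ)`. -/
structure HasDiscreteDichotomy (K : ℝ) : Prop where
  nonneg : 0 ≤ K
  exists_solution : ∀ x : E, ∃ w : ℤ → E, (∀ n, n ≠ 0 → w (n + 1) = S (w n)) ∧
    w 1 = S (w 0) + S x ∧ (Summable fun n => ‖w n‖ ^ 2) ∧ ∑' n, ‖w n‖ ^ 2 ≤ K * ‖x‖ ^ 2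
  unique : ∀ w : ℤ → E, (∀ n, w (n + 1) = S (w n)) → (Summable fun n => ‖w n‖ ^ 2) → ∀ n, w n = 0

namespace HasDiscreteDichotomy

variable {K : ℝ} (h : HasDiscreteDichotomy S K)
include h

theorem exists_decomposition (x : E) : ∃ y z : E, ∃ v : ℕ → E, x = y + z ∧
    y ∈ stableSubspace S ∧ ∑' n, ‖(S ^ n) y‖ ^ 2 ≤ (2 + 2 * K) * ‖x‖ ^ 2 ∧
    IsBackwardOrbit S z v ∧ ∑' n, ‖v n‖ ^ 2 ≤ (2 + 2 * K) * ‖x‖ ^ 2 := by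
  obtain ⟨w, hw, hw1, hs, hK⟩ := h.exists_solution x
  have hpow : ∀ n : ℕ, (S ^ (n + 1)) (x + w 0) = w (n + 1 : ℕ) := by
    intro n
    induction n with
    | zero => simp [hw1, add_comm]
    | succ n ih =>
      rw [pow_succ', mul_apply_eq_comp, ih, ← hw _ (by positivity)]
      push_cast; rfl
  have hinj : Function.Injective fun n : ℕ => ((n + 1 : ℕ) : ℤ) := fun a b hab => by
    simpa using hab
  have hinj' : Function.Injective fun n : ℕ => (-(n : ℤ)) := fun a b hab => by
    simpa using hab
  have hs1 : Summable fun n : ℕ => ‖w (n + 1 : ℕ)‖ ^ 2 := hs.comp_injective hinj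
  have hs2 : Summable fun n : ℕ => ‖w (-(n : ℤ))‖ ^ 2 := hs.comp_injective hinj'
  have hsy : Summable fun n : ℕ => ‖(S ^ n) (x + w 0)‖ ^ 2 := by
    refine (summable_nat_add_iff 1).1 ?_
    simpa only [hpow] using hs1
  have hw0 : ‖w 0‖ ^ 2 ≤ K * ‖x‖ ^ 2 :=
    (hs.le_tsum 0 fun _ _ => by positivity).trans hK
  have hle : ∑' n : ℕ, ‖w (n + 1 : ℕ)‖ ^ 2 + ‖w 0‖ ^ 2 ≤ K * ‖x‖ ^ 2 := by
    have hinj0 : Function.Injective fun n : ℕ => (n : ℤ) := Nat.cast_injective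
    have h1 := tsum_comp_le_tsum_of_inj hs (fun _ => by positivity) hinj0
    have h2 := (hs.comp_injective hinj0).tsum_eq_zero_add
    simp only [Function.comp_def] at h1 h2
    rw [h2] at h1
    push_cast at h1 ⊢
    linarith
  have hx0 : ‖x + w 0‖ ^ 2 ≤ 2 * ‖x‖ ^ 2 + 2 * ‖w 0‖ ^ 2 := by
    have := norm_add_le x (w 0)
    nlinarith [norm_nonneg (x + w 0), sq_nonneg (‖x‖ - ‖w 0‖)]
  -- The jump at n = 0 gives w 1 = S (x + w 0), so positive times continue the forward orbit of x +
  -- w 0, while negative times are a backward orbit of w 0. For the constant 2 + 2K, combine ‖x + w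
  -- 0‖² ≤ 2‖x‖² + 2‖w 0‖² with the ℓ² bound on w.
  refine ⟨x + w 0, -w 0, fun n => -w (-(n : ℤ)), by simp, hsy, ?_, ⟨by simp, fun n => ?_, ?_⟩, ?_⟩
  · rw [hsy.tsum_eq_zero_add]
    simp only [hpow, pow_zero, one_apply_eq_self]
    nlinarith [sq_nonneg ‖x‖, sq_nonneg ‖w 0‖]
  · rw [map_neg, ← hw _ (by simp; omega)]
    congr 2
    push_cast
    ring
  · simpa only [norm_neg] using hs2
  · simp only [norm_neg]
    have := tsum_comp_le_tsum_of_inj hs (fun _ => by positivity) hinj'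
    simp only [Function.comp_def] at this
    nlinarith [sq_nonneg ‖x‖, h.nonneg]

/-- Gluing the forward and the backward orbit at x produces an ℓ²(ℤ) solution of the homogeneous
equation, which must vanish. -/
theorem eq_zero_of_mem (hs : x ∈ stableSubspace S) (hu : x ∈ unstableSubspace S) : x = 0 := by
  obtain ⟨v, hv⟩ := hu
  set w : ℤ → E := fun n => Int.rec (fun k => (S ^ k) x) (fun k => v (k + 1)) n with hw
  refine h.unique w (fun n => ?_) ?_ 0
  · cases n with
    | ofNat k =>
      change (S ^ (k + 1)) x = S ((S ^ k) x)
      rw [pow_succ']; rfl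
    | negSucc k =>
      cases k with
      | zero => exact (by simpa [hv.1] using (hv.2 0).symm : x = S (v 1))
      | succ k => exact (hv.2 (k + 1)).symm
  · refine Summable.of_nat_of_neg_add_one hs ?_
    refine ((summable_nat_add_iff 1).2 hv.3).congr fun n => ?_
    have : (-((n : ℤ) + 1)) = Int.negSucc n := by omega
    rw [this]

theorem isCompl : IsCompl (stableSubspace S) (unstableSubspace S) := by
  refine ⟨?_, ?_⟩
  · rw [Submodule.disjoint_def]
    exact fun x hs hu => h.eq_zero_of_mem hs hu
  · rw [codisjoint_iff, eq_top_iff]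
    intro x _
    obtain ⟨y, z, v, rfl, hy, -, hv, -⟩ := h.exists_decomposition x
    exact Submodule.add_mem_sup hy ⟨v, hv⟩

theorem tsum_stable_le (hx : x ∈ stableSubspace S) :
    ∑' n, ‖(S ^ n) x‖ ^ 2 ≤ (2 + 2 * K) * ‖x‖ ^ 2 := by
  obtain ⟨y, z, v, hxyz, hy, hy', hv, -⟩ := h.exists_decomposition x
  have hz : z = 0 := h.eq_zero_of_mem
    (by simpa [hxyz] using (stableSubspace S).sub_mem hx hy) ⟨v, hv⟩
  rw [hz, add_zero] at hxyz
  rwa [← hxyz] at hy'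

theorem exists_backward_orbit (hx : x ∈ unstableSubspace S) :
    ∃ v, IsBackwardOrbit S x v ∧ ∑' n, ‖v n‖ ^ 2 ≤ (2 + 2 * K) * ‖x‖ ^ 2 := by
  obtain ⟨y, z, v, hxyz, hy, -, hv, hv'⟩ := h.exists_decomposition x
  have hz : y = 0 := h.eq_zero_of_mem hy
    (by simpa [hxyz] using (unstableSubspace S).sub_mem hx ⟨v, hv⟩)
  rw [hz, zero_add] at hxyz
  rw [← hxyz] at hv
  exact ⟨v, hv, hv'⟩

/-- Subtracting an element u of one subspace from x leaves the component of x in the other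
unchanged, by uniqueness of the splitting. That component is therefore bounded by a multiple of ‖x -
u‖, and vanishes when such u converge to x. -/
theorem isClosed : IsClosed (stableSubspace S : Set E) ∧ IsClosed (unstableSubspace S : Set E) := by
  have hK := h.nonneg
  have key : ∀ x : E, ∃ y z : E, x = y + z ∧ y ∈ stableSubspace S ∧ z ∈ unstableSubspace S ∧
      ‖y‖ ^ 2 ≤ (2 + 2 * K) * ‖x‖ ^ 2 ∧ ‖z‖ ^ 2 ≤ (2 + 2 * K) * ‖x‖ ^ 2 := by
    intro x
    obtain ⟨y, z, v, hxyz, hy, hy', hv, hv'⟩ := h.exists_decomposition x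
    refine ⟨y, z, hxyz, hy, ⟨v, hv⟩, le_trans ?_ hy', le_trans ?_ hv'⟩
    · simpa using Summable.le_tsum hy 0 fun _ _ => by positivity
    · simpa [hv.1] using hv.3.le_tsum 0 fun _ _ => by positivity
  have lim : ∀ (u : ℕ → E) (x y : E), Tendsto u atTop (𝓝 x) →
      (∀ n, ‖y‖ ^ 2 ≤ (2 + 2 * K) * ‖x - u n‖ ^ 2) → y = 0 := by
    intro u x y hu hy
    have h1 : Tendsto (fun n => (2 + 2 * K) * ‖x - u n‖ ^ 2) atTop (𝓝 0) := by
      have := ((tendsto_const_nhds (x := x)).sub hu).norm.pow 2 |>.const_mul (2 + 2 * K)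
      simpa using this
    have := ge_of_tendsto' h1 hy
    have h2 : ‖y‖ ^ 2 = 0 := le_antisymm this (by positivity)
    simpa using h2
  have hdis := fun x => h.eq_zero_of_mem (x := x)
  constructor
  · refine IsSeqClosed.isClosed fun u x hu hx => ?_
    obtain ⟨y, z, hxyz, hy, hz, -, -⟩ := key x
    have : z = 0 := lim u x z hx fun n => by
      obtain ⟨y', z', hn, hy', hz', -, hb⟩ := key (x - u n)
      have h0 : z - z' = 0 := by
        refine hdis _ ?_ ((unstableSubspace S).sub_mem hz hz')
        have : z - z' = (y' + u n) - y := by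
          rw [sub_eq_iff_eq_add] at hn
          rw [sub_eq_sub_iff_add_eq_add, add_comm, ← hxyz, hn]; abel
        rw [this]
        exact (stableSubspace S).sub_mem ((stableSubspace S).add_mem hy' (hu n)) hy
      rw [sub_eq_zero.1 h0]
      exact hb
    rw [hxyz, this, add_zero]
    exact hy
  · refine IsSeqClosed.isClosed fun u x hu hx => ?_
    obtain ⟨y, z, hxyz, hy, hz, -, -⟩ := key x
    have : y = 0 := lim u x y hx fun n => by
      obtain ⟨y', z', hn, hy', hz', hb, -⟩ := key (x - u n)
      have h0 : y - y' = 0 := by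
        refine hdis _ ((stableSubspace S).sub_mem hy hy') ?_
        have : y - y' = (z' + u n) - z := by
          rw [sub_eq_iff_eq_add] at hn
          rw [sub_eq_sub_iff_add_eq_add, ← hxyz, hn]; abel
        rw [this]
        exact (unstableSubspace S).sub_mem ((unstableSubspace S).add_mem hz' (hu n)) hz
      rw [sub_eq_zero.1 h0]
      exact hb
    rw [hxyz, this, zero_add]
    exact hz

/-- For every k ≤ n the vector Sⁿx lies on the forward orbit of Sᵏx, so the ℓ² bound controls ‖Sⁿx‖²
by ‖Sᵏx‖². Adding these n + 1 inequalities and using the ℓ² bound for x once more gains the factor n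
+ 1. -/
theorem stable_pow_le (hx : x ∈ stableSubspace S) (n : ℕ) :
    (n + 1) * ‖(S ^ n) x‖ ^ 2 ≤ (2 + 2 * K) ^ 2 * ‖x‖ ^ 2 := by
  have hK := h.nonneg
  have h1 : ∀ k ∈ Finset.range (n + 1), ‖(S ^ n) x‖ ^ 2 ≤ (2 + 2 * K) * ‖(S ^ k) x‖ ^ 2 := by
    intro k hk
    have hm := pow_mem_stableSubspace hx k
    refine le_trans ?_ (h.tsum_stable_le hm)
    have := Summable.le_tsum hm (n - k) fun _ _ => by positivity
    rwa [← mul_apply_eq_comp, ← pow_add,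
      Nat.sub_add_cancel (Nat.lt_succ_iff.1 (Finset.mem_range.1 hk))] at this
  have h2 := Finset.sum_le_sum h1
  rw [Finset.sum_const, Finset.card_range, nsmul_eq_mul, ← Finset.mul_sum] at h2
  have h3 := (Summable.sum_le_tsum (Finset.range (n + 1)) (fun _ _ => by positivity) hx).trans
    (h.tsum_stable_le hx)
  rw [Nat.cast_succ] at h2
  nlinarith

theorem injOn_unstable (n : ℕ) (hx : x ∈ unstableSubspace S) (h0 : (S ^ n) x = 0) : x = 0 := by
  refine h.eq_zero_of_mem ?_ hx
  refine (summable_nat_add_iff n).1 ?_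
  simp [pow_add, h0, summable_zero]

/-- Since S is injective on the unstable subspace, the ℓ² backward orbit of Sᵐx retraces x, Sx, …,
Sᵐx. Hence ∑_{k≤m} ‖Sᵏx‖² is controlled by ‖Sᵐx‖², and the averaging argument runs in reverse time.
-/
theorem unstable_pow_le (hx : x ∈ unstableSubspace S) (n : ℕ) :
    (n + 1) * ‖x‖ ^ 2 ≤ (2 + 2 * K) ^ 2 * ‖(S ^ n) x‖ ^ 2 := by
  have hK := h.nonneg
  have hmem : ∀ k, (S ^ k) x ∈ unstableSubspace S := by
    intro k
    obtain ⟨v, hv⟩ := hx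
    exact ⟨fun j => (S ^ k) (v j), by simp [hv.1], fun j => by
      rw [← mul_apply_eq_comp, ← pow_succ', pow_succ,
        mul_apply_eq_comp, hv.2], by
      refine Summable.of_nonneg_of_le (fun _ => by positivity) (fun j => ?_)
        (hv.3.mul_left (‖S ^ k‖ ^ 2))
      rw [← mul_pow]
      gcongr
      exact ContinuousLinearMap.le_opNorm _ _⟩
  have key : ∀ m, ∑ k ∈ Finset.range (m + 1), ‖(S ^ k) x‖ ^ 2 ≤
      (2 + 2 * K) * ‖(S ^ m) x‖ ^ 2 := by
    intro m
    obtain ⟨v, hv, hvK⟩ := h.exists_backward_orbit (hmem m)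
    have hvm : v m = x := by
      rw [← sub_eq_zero]
      refine h.injOn_unstable m ((unstableSubspace S).sub_mem (hv.mem m) hx) ?_
      have := hv.pow_apply m 0
      rw [zero_add, hv.1] at this
      rw [map_sub, this, sub_self]
    refine le_trans ?_ hvK
    rw [← Finset.sum_range_reflect]
    refine le_trans (le_of_eq (Finset.sum_congr rfl fun k hk => ?_))
      (hv.3.sum_le_tsum (Finset.range (m + 1)) fun _ _ => by positivity)
    have hk' := Nat.lt_succ_iff.1 (Finset.mem_range.1 hk)
    have := hv.pow_apply (m - k) k
    rw [Nat.add_sub_cancel' hk', hvm] at this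
    rw [← this, Nat.add_sub_cancel]
  have h1 : ∀ k ∈ Finset.range (n + 1), ‖x‖ ^ 2 ≤ (2 + 2 * K) * ‖(S ^ k) x‖ ^ 2 := by
    intro k _
    refine le_trans ?_ (key k)
    have := Finset.single_le_sum (f := fun k => ‖(S ^ k) x‖ ^ 2) (s := Finset.range (k + 1))
      (fun _ _ => by positivity) (Finset.mem_range.2 k.succ_pos)
    simpa using this
  have h2 := Finset.sum_le_sum h1
  rw [Finset.sum_const, Finset.card_range, nsmul_eq_mul, ← Finset.mul_sum] at h2
  have h3 := key n
  rw [Nat.cast_succ] at h2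
  nlinarith

end HasDiscreteDichotomy

theorem exists_nat_mul_le {τ : ℝ≥0} (hτ : 0 < τ) (t : ℝ≥0) :
    ∃ (m : ℕ) (s : ℝ≥0), s ≤ τ ∧ t = m * τ + s := by
  refine ⟨⌊t / τ⌋₊, t - ⌊t / τ⌋₊ * τ, ?_, (add_tsub_cancel_of_le ?_).symm⟩
  · rw [tsub_le_iff_left, ← add_one_mul]
    have := (Nat.lt_floor_add_one (t / τ)).le
    rwa [div_le_iff₀ hτ] at this
  · rw [← le_div_iff₀ hτ]
    exact Nat.floor_le zero_le

theorem C0Semigroup.op_nat_mul (T : C0Semigroup E) (m : ℕ) (τ : ℝ≥0) :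
    T.op (m * τ) = T.op τ ^ m := by
  induction m with
  | zero => simp [T.op_zero]; rfl
  | succ n ih => rw [Nat.cast_succ, add_one_mul, T.op_add, ih, pow_succ]; rfl

theorem half_pow_eq_exp (m : ℕ) : (1 / 2 : ℝ) ^ m = Real.exp (-(Real.log 2 * m)) := by
  rw [Real.exp_neg, mul_comm, Real.exp_nat_mul, Real.exp_log (by norm_num)]
  simp

variable [CompleteSpace E] {T : C0Semigroup E}

theorem C0Semigroup.exists_exp_decay (T : C0Semigroup E) {τ : ℝ≥0} (hτ : 0 < τ)
    {Es Eu : Submodule ℂ E} (hs : ∀ x ∈ Es, T.op τ x ∈ Es ∧ ‖T.op τ x‖ ≤ 1 / 2 * ‖x‖)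
    (hu : ∀ x ∈ Eu, T.op τ x ∈ Eu ∧ ‖x‖ ≤ 1 / 2 * ‖T.op τ x‖) :
    ∃ M ε : ℝ, 0 < ε ∧
      (∀ t : ℝ≥0, ∀ x ∈ Es, ‖T.op t x‖ ≤ M * Real.exp (-ε * t) * ‖x‖) ∧
      (∀ t : ℝ≥0, ∀ x ∈ Eu, ‖x‖ ≤ M * Real.exp (-ε * t) * ‖T.op t x‖) := by
  obtain ⟨M, hM1, hM⟩ := T.exists_norm_op_le_of_le τ
  have hτ' : (0 : ℝ) < τ := hτ
  have hlog : 0 < Real.log 2 := Real.log_pos (by norm_num)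
  have hs' : ∀ m : ℕ, ∀ x ∈ Es, ‖(T.op τ ^ m) x‖ ≤ (1 / 2) ^ m * ‖x‖ := by
    intro m
    induction m with
    | zero => simp
    | succ m ih =>
      intro x hx
      rw [pow_succ, mul_apply_eq_comp]
      refine (ih _ (hs x hx).1).trans ?_
      rw [pow_succ, mul_assoc]
      gcongr
      exact (hs x hx).2
  have hu' : ∀ m : ℕ, ∀ x ∈ Eu, ‖x‖ ≤ (1 / 2) ^ m * ‖(T.op τ ^ m) x‖ := by
    intro m
    induction m with
    | zero => simp
    | succ m ih =>
      intro x hx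
      refine (hu x hx).2.trans ?_
      rw [pow_succ (T.op τ), mul_apply_eq_comp, pow_succ', mul_assoc]
      gcongr
      exact ih _ (hu x hx).1
  -- One factor 1/2 per time τ gives the rate (log 2)/τ. M bounds the semigroup on the leftover time
  -- in [0, τ], and the 2 pays for the incomplete last period in the stable estimate.
  refine ⟨2 * M, Real.log 2 / τ, by positivity, fun t x hx => ?_, fun t x hx => ?_⟩
  · obtain ⟨m, s, hsτ, rfl⟩ := exists_nat_mul_le hτ t
    rw [add_comm, T.op_add_apply, T.op_nat_mul]
    have h1 : Real.exp (-(Real.log 2 * m)) ≤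
        2 * Real.exp (-(Real.log 2 / τ) * ((s + m * τ : ℝ≥0) : ℝ)) := by
      conv_rhs => rw [← Real.exp_log (show (0 : ℝ) < 2 by norm_num), ← Real.exp_add]
      rw [Real.exp_le_exp, Real.log_exp]
      push_cast
      have : Real.log 2 / τ * s ≤ Real.log 2 := by
        rw [div_mul_eq_mul_div, div_le_iff₀ hτ']
        gcongr
      have h3 : Real.log 2 / τ * (m * τ) = Real.log 2 * m := by field_simp
      rw [neg_mul, mul_add, h3]
      linarith
    calc ‖T.op s ((T.op τ ^ m) x)‖ ≤ ‖T.op s‖ * ‖(T.op τ ^ m) x‖ := (T.op s).le_opNorm _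
      _ ≤ M * ((1 / 2) ^ m * ‖x‖) := by
        gcongr
        · exact hM s hsτ
        · exact hs' m x hx
      _ ≤ _ := by
        rw [half_pow_eq_exp, ← mul_assoc]
        refine mul_le_mul_of_nonneg_right ?_ (norm_nonneg x)
        rw [mul_comm 2 M, mul_assoc M]
        gcongr
  · obtain ⟨m, s, hsτ, hts⟩ := exists_nat_mul_le hτ t
    -- In the unstable direction time is rounded up to a multiple of τ: the expansion bound is known
    -- there, and passing from T(t)x to the later time costs only a bounded operator.
    have hd : ((m + 1 : ℕ) : ℝ≥0) * τ = (τ - s) + t := by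
      rw [hts, add_comm (m * τ : ℝ≥0), ← add_assoc, tsub_add_cancel_of_le hsτ]
      push_cast
      ring
    have h0 := hu' (m + 1) x hx
    rw [← T.op_nat_mul, hd, T.op_add_apply, half_pow_eq_exp] at h0
    refine h0.trans ?_
    have h1 : Real.exp (-(Real.log 2 * (m + 1 : ℕ))) ≤
        Real.exp (-(Real.log 2 / τ) * (t : ℝ)) := by
      rw [Real.exp_le_exp]
      have h4 : (t : ℝ) ≤ ((m + 1 : ℕ) : ℝ) * τ := by
        rw [hts]
        push_cast
        have : (s : ℝ) ≤ τ := hsτ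
        linarith
      have h5 : Real.log 2 / τ * t ≤ Real.log 2 / τ * (((m + 1 : ℕ) : ℝ) * τ) := by gcongr
      have h3 : Real.log 2 / τ * (((m + 1 : ℕ) : ℝ) * τ) = Real.log 2 * (m + 1 : ℕ) := by field_simp
      linarith
    have h2 : ‖T.op (τ - s) (T.op t x)‖ ≤ 2 * M * ‖T.op t x‖ := by
      refine ((T.op _).le_opNorm _).trans ?_
      gcongr
      linarith [hM (τ - s) tsub_le_self]
    calc _ ≤ Real.exp (-(Real.log 2 / τ) * (t : ℝ)) * (2 * M * ‖T.op t x‖) := by gcongr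
      _ = _ := by ring

/-- The averaged bounds (n + 1)a² ≤ (2 + 2K)²b² become a ≤ b/2 for large n, giving contraction and
expansion at one fixed time. Invariance under all T(t) follows because T(t) commutes with T(1) and
maps ℓ² orbits to ℓ² orbits. -/
theorem HasDiscreteDichotomy.isHyperbolic {K : ℝ} (h : HasDiscreteDichotomy (T.op 1) K) :
    T.IsHyperbolic := by
  have hpow : ∀ (n : ℕ) (x : E), (T.op 1 ^ n) x = T.op n x := fun n x => by rw [T.op_nat]
  have hsm : ∀ t, ∀ x ∈ stableSubspace (T.op 1), T.op t x ∈ stableSubspace (T.op 1) := by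
    intro t x hx
    refine Summable.of_nonneg_of_le (fun _ => by positivity) (fun n => ?_)
      (Summable.mul_left (‖T.op t‖ ^ 2) hx)
    rw [hpow, hpow, T.op_comm, ← mul_pow]
    gcongr
    exact (T.op t).le_opNorm _
  have hum : ∀ t, ∀ x ∈ unstableSubspace (T.op 1), T.op t x ∈ unstableSubspace (T.op 1) := by
    rintro t x ⟨v, hv⟩
    refine ⟨fun n => T.op t (v n), by rw [hv.1], fun n => by rw [T.op_comm, hv.2], ?_⟩
    refine Summable.of_nonneg_of_le (fun _ => by positivity) (fun n => ?_)
      (hv.3.mul_left (‖T.op t‖ ^ 2))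
    rw [← mul_pow]
    gcongr
    exact (T.op t).le_opNorm _
  obtain ⟨N, hN⟩ := exists_nat_ge (4 * (2 + 2 * K) ^ 2)
  have hhalf : ∀ a b : ℝ, 0 ≤ a → 0 ≤ b →
      ((N + 1 : ℕ) + 1) * a ^ 2 ≤ (2 + 2 * K) ^ 2 * b ^ 2 → a ≤ 1 / 2 * b := by
    intro a b ha hb hab
    have h4 : 4 * a ^ 2 ≤ b ^ 2 := by
      have hpos : 0 < (2 + 2 * K) ^ 2 := by have := h.nonneg; positivity
      push_cast at hab
      have : (2 + 2 * K) ^ 2 * (4 * a ^ 2) ≤ (2 + 2 * K) ^ 2 * b ^ 2 := by nlinarith [sq_nonneg a]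
      exact le_of_mul_le_mul_left this hpos
    nlinarith
  have hex := T.exists_exp_decay (τ := (N + 1 : ℕ)) (by positivity)
    (Es := stableSubspace (T.op 1)) (Eu := unstableSubspace (T.op 1))
    (fun x hx => ⟨hsm _ x hx, hhalf _ _ (norm_nonneg _) (norm_nonneg _) (by
      rw [← hpow]; exact h.stable_pow_le hx (N + 1))⟩)
    (fun x hx => ⟨hum _ x hx, hhalf _ _ (norm_nonneg _) (norm_nonneg _) (by
      rw [← hpow]; exact h.unstable_pow_le hx (N + 1))⟩)
  refine ⟨stableSubspace (T.op 1), unstableSubspace (T.op 1), h.isClosed.1, h.isClosed.2,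
    h.isCompl, hsm, fun t => ⟨hum t, ?_, ?_⟩, hex⟩
  · obtain ⟨M, ε, -, -, hMu⟩ := hex
    intro x hx y hy hxy
    have := hMu t (x - y) ((unstableSubspace _).sub_mem hx hy)
    rw [map_sub, show T.op t x = T.op t y from hxy, sub_self, norm_zero, mul_zero, norm_le_zero_iff] at this
    exact sub_eq_zero.1 this
  -- A preimage under T(t) is found by going back m ≥ t whole steps along the backward orbit and
  -- then forward by time m - t.
  · rintro x ⟨v, hv⟩
    obtain ⟨m, hm⟩ := exists_nat_ge t
    refine ⟨T.op (m - t) (v m), hum _ _ (hv.mem m), ?_⟩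
    rw [← T.op_add_apply, add_tsub_cancel_of_le hm, ← hpow]
    simpa [hv.1] using hv.pow_apply m 0

end Dichotomy

/-! ### Passage between L²(ℝ) and ℓ²(ℤ) -/

section SquareIntegrable

theorem eLpNorm_two_sq {α E : Type*} [MeasurableSpace α] [NormedAddCommGroup E] (μ : Measure α)
    (f : α → E) : eLpNorm f 2 μ ^ 2 = ∫⁻ t, ‖f t‖ₑ ^ 2 ∂μ := by
  have := eLpNorm_nnreal_pow_eq_lintegral (f := f) (μ := μ) (p := 2) (by norm_num)
  simpa using this

/-- Folding the line onto one period: square integrability of a function becomes an average, over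
the offset in a unit interval, of ℓ² sums over ℤ. -/
theorem lintegral_eq_setLIntegral_tsum {f : ℝ → ℝ≥0∞} (hf : AEMeasurable f) (a : ℝ) :
    ∫⁻ t, f t = ∫⁻ t in Ioc a (a + 1), ∑' n : ℤ, f (t + n) := by
  have h : ∀ n : ℤ, ∫⁻ t in Ioc (a + n) (a + n + 1), f t = ∫⁻ t in Ioc a (a + 1), f (t + n) := by
    intro n
    rw [← (measurePreserving_add_right volume (n : ℝ)).setLIntegral_comp_preimage_emb
      (measurableEmbedding_addRight (n : ℝ))]
    congr 2
    ext t
    simp only [mem_preimage, mem_Ioc]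
    constructor <;> rintro ⟨h1, h2⟩ <;> constructor <;> linarith
  calc ∫⁻ t, f t = ∫⁻ t in ⋃ n : ℤ, Ioc (a + n) (a + n + 1), f t := by
        rw [iUnion_Ioc_add_intCast, setLIntegral_univ]
    _ = ∑' n : ℤ, ∫⁻ t in Ioc (a + n) (a + n + 1), f t :=
        lintegral_iUnion (fun _ => measurableSet_Ioc) (pairwise_disjoint_Ioc_add_intCast a) _
    _ = ∑' n : ℤ, ∫⁻ t in Ioc a (a + 1), f (t + n) := by simp only [h]
    _ = ∫⁻ t in Ioc a (a + 1), ∑' n : ℤ, f (t + n) := by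
        rw [lintegral_tsum]
        exact fun n => (hf.comp_quasiMeasurePreserving
          (measurePreserving_add_right volume (n : ℝ)).quasiMeasurePreserving).restrict

theorem summable_norm_sq_of_tsum_enorm_sq_le {ι E : Type*} [NormedAddCommGroup E] {w : ι → E}
    {c : ℝ} (hc : 0 ≤ c) (h : ∑' n, ‖w n‖ₑ ^ 2 ≤ ENNReal.ofReal c) :
    (Summable fun n => ‖w n‖ ^ 2) ∧ ∑' n, ‖w n‖ ^ 2 ≤ c := by
  have h1 : ∀ n, ‖w n‖ₑ ^ 2 = ENNReal.ofReal (‖w n‖ ^ 2) := fun n => by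
    rw [ENNReal.ofReal_pow (norm_nonneg _), ofReal_norm]
  simp only [h1] at h
  have hs : Summable fun n => ‖w n‖ ^ 2 := by
    have := ENNReal.summable_toReal (ne_top_of_le_ne_top ENNReal.ofReal_ne_top h)
    refine this.congr fun n => ENNReal.toReal_ofReal (by positivity)
  refine ⟨hs, ?_⟩
  rw [← ENNReal.ofReal_tsum_of_nonneg (fun _ => by positivity) hs] at h
  exact (ENNReal.ofReal_le_ofReal_iff hc).1 h

end SquareIntegrable

/-! ### Gearhart's theorem on Hilbert spaces -/

section Gearhart

open FourierTransform C0Semigroup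

variable {H : Type*} [NormedAddCommGroup H] [InnerProductSpace ℂ H] [CompleteSpace H]
  {T : C0Semigroup H} {A : H →ₗ.[ℂ] H} {R : ℝ → H →L[ℂ] H} {C : ℝ}

omit [CompleteSpace H] in
theorem IsResolventAt.sub_apply {z z' : ℂ} {R R' : H →L[ℂ] H} (hR : IsResolventAt A z R)
    (hR' : IsResolventAt A z' R') (x : H) : R x - R' x = (z' - z) • R (R' x) := by
  have := hR.eq_of_mem_graph (hR'.mem_graph x)
  rw [map_sub, map_sub, map_smul, map_smul] at this
  nth_rw 1 [← this]
  module

-- The resolvent identity and the uniform bound make s ↦ R(is)x Lipschitz; this supplies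
-- measurability along the axis.
omit [CompleteSpace H] in
theorem continuous_resolvent_line (hR : ∀ s : ℝ, IsResolventAt A (s * Complex.I) (R s))
    (hC : ∀ s, ‖R s‖ ≤ C) (x : H) : Continuous fun s => R s x := by
  have hC0 : 0 ≤ C := (norm_nonneg _).trans (hC 0)
  have : LipschitzWith (C * (C * ‖x‖)).toNNReal fun s => R s x := by
    refine LipschitzWith.of_dist_le_mul fun s s' => ?_
    rw [dist_eq_norm, (hR s).sub_apply (hR s'), norm_smul, Real.coe_toNNReal _ (by positivity),
      mul_comm, dist_comm, Real.dist_eq, ← sub_mul, norm_mul, Complex.norm_I, mul_one,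
      ← Complex.ofReal_sub, Complex.norm_real, Real.norm_eq_abs]
    gcongr
    exact (R s).le_of_opNorm_le_of_le (hC s) ((R s').le_of_opNorm_le (hC s') x)
  exact this.continuous

/-- The Laplace transform of the orbits on a vertical line, as a Fourier transform of a square
integrable function. -/
theorem exists_fourier_mem_graph (hA : T.IsGenerator A) :
    ∃ ω K : ℝ, 0 ≤ ω ∧ 0 ≤ K ∧ ∀ x : H, ∃ g : ℝ → H, Integrable g ∧ MemLp g 2 ∧
      eLpNorm g 2 ≤ ENNReal.ofReal (K * ‖x‖) ∧ ∀ s : ℝ,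
      (𝓕 g s, ((ω : ℂ) + (2 * Real.pi * s : ℝ) * Complex.I) • 𝓕 g s - x) ∈ A.graph := by
  obtain ⟨M, ω, hM1, hω, hM⟩ := T.exists_norm_op_le_exp
  set e : ℝ → ℝ := (Ioi 0).indicator fun t => Real.exp (-t) with he
  have hei : IntegrableOn (fun t : ℝ => Real.exp (-t)) (Ioi 0) := by
    simpa using exp_neg_integrableOn_Ioi 0 one_pos
  have he2 : MemLp e 2 := by
    rw [he, memLp_indicator_iff_restrict measurableSet_Ioi, memLp_two_iff_integrable_sq
      (by fun_prop)]
    refine (exp_neg_integrableOn_Ioi 0 (b := 2) (by norm_num)).congr_fun (fun t _ => ?_)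
      measurableSet_Ioi
    change Real.exp (-2 * t) = Real.exp (-t) ^ 2
    rw [← Real.exp_nat_mul, Nat.cast_ofNat, neg_mul, mul_neg]
  -- Damping at rate ω + 1 against growth e^{ωt} leaves the weight e = e^{-t} on (0, ∞), whose L²
  -- norm enters the constant.
  refine ⟨ω + 1, M * (eLpNorm e 2).toReal, by positivity, by positivity, fun x => ?_⟩
  set g : ℝ → H := (Ioi 0).indicator fun t : ℝ =>
    Complex.exp (-((ω + 1 : ℝ) : ℂ) * t) • T.op t.toNNReal x with hg
  have hgm : AEStronglyMeasurable g :=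
    (T.continuous_exp_smul_orbit _ x).aestronglyMeasurable.indicator measurableSet_Ioi
  have hge : ∀ t, ‖g t‖ ≤ (M * ‖x‖) * ‖e t‖ := by
    intro t
    by_cases ht : t ∈ Ioi (0 : ℝ)
    · rw [hg, he, indicator_of_mem ht, indicator_of_mem ht, norm_smul, Complex.norm_exp,
        Real.norm_eq_abs, Real.abs_exp]
      have h1 : ‖T.op t.toNNReal x‖ ≤ M * Real.exp (ω * t) * ‖x‖ := by
        have := (T.op t.toNNReal).le_of_opNorm_le (hM t.toNNReal) x
        rwa [Real.coe_toNNReal _ (le_of_lt ht)] at this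
      have h2 : (-((ω + 1 : ℝ) : ℂ) * t).re = -(ω + 1) * t := by simp
      rw [h2]
      calc Real.exp (-(ω + 1) * t) * ‖T.op t.toNNReal x‖
          ≤ Real.exp (-(ω + 1) * t) * (M * Real.exp (ω * t) * ‖x‖) := by gcongr
        _ = M * ‖x‖ * (Real.exp (-(ω + 1) * t) * Real.exp (ω * t)) := by ring
        _ = M * ‖x‖ * Real.exp (-t) := by rw [← Real.exp_add]; ring_nf
    · rw [hg, he, indicator_of_notMem ht, indicator_of_notMem ht]
      simp
  have hgi : Integrable g := by
    have h1 : Integrable e := (integrable_indicator_iff measurableSet_Ioi).2 hei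
    exact (h1.norm.const_mul (M * ‖x‖)).mono' hgm (Eventually.of_forall hge)
  have hg2 : MemLp g 2 := he2.of_le_mul hgm (Eventually.of_forall hge)
  refine ⟨g, hgi, hg2, ?_, fun s => ?_⟩
  · refine (eLpNorm_le_mul_eLpNorm_of_ae_le_mul (Eventually.of_forall hge) _).trans (le_of_eq ?_)
    rw [← ENNReal.ofReal_toReal he2.2.ne, ← ENNReal.ofReal_mul (by positivity),
      ENNReal.toReal_ofReal (by positivity)]
    ring_nf
  · set z : ℂ := ((ω + 1 : ℝ) : ℂ) + (2 * Real.pi * s : ℝ) * Complex.I with hz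
    have h1 : (fun t : ℝ => Complex.exp ((-2 * Real.pi * t * s : ℝ) * Complex.I) • g t) =
        (Ioi 0).indicator fun r : ℝ => Complex.exp (-z * r) • T.op r.toNNReal x := by
      ext t
      by_cases ht : t ∈ Ioi (0 : ℝ)
      · rw [hg, indicator_of_mem ht, indicator_of_mem ht, smul_smul, ← Complex.exp_add]
        congr 2
        rw [hz]
        push_cast
        ring
      · rw [hg, indicator_of_notMem ht, indicator_of_notMem ht, smul_zero]
    have h2 : IntegrableOn (fun r : ℝ => Complex.exp (-z * r) • T.op r.toNNReal x) (Ioi 0) := by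
      rw [← integrable_indicator_iff measurableSet_Ioi, ← h1]
      refine hgi.mono ?_ (Eventually.of_forall fun t => ?_)
      · exact (by fun_prop : Continuous fun t : ℝ =>
          Complex.exp ((-2 * Real.pi * t * s : ℝ) * Complex.I)).aestronglyMeasurable.smul hgm
      · rw [norm_smul, Complex.norm_exp_ofReal_mul_I, one_mul]
    have h3 := hA.laplace_mem_graph x z h2
    rw [← integral_indicator measurableSet_Ioi, ← h1,
      ← Real.fourier_real_eq_integral_exp_smul] at h3
    exact h3

/-- The resolvent on the imaginary axis is square integrable along vectors. -/
theorem exists_eLpNorm_resolvent_le (hA : T.IsGenerator A)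
    (hR : ∀ s : ℝ, IsResolventAt A (s * Complex.I) (R s)) (hC : ∀ s, ‖R s‖ ≤ C) :
    ∃ K : ℝ, 0 ≤ K ∧ ∀ x : H, MemLp (fun s : ℝ => R (2 * Real.pi * s) x) 2 ∧
      eLpNorm (fun s : ℝ => R (2 * Real.pi * s) x) 2 ≤ ENNReal.ofReal (K * ‖x‖) := by
  obtain ⟨ω, K, hω, hK, hg⟩ := exists_fourier_mem_graph hA
  have hC0 : 0 ≤ C := (norm_nonneg _).trans (hC 0)
  have hD0 : 0 ≤ 1 + ω * C := by positivity
  refine ⟨(1 + ω * C) * K, by positivity, fun x => ?_⟩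
  obtain ⟨g, hgi, hg2, hgK, hgr⟩ := hg x
  have hpair := isFourierPair_of_integrable hgi hg2
  have hle : ∀ s : ℝ, ‖R (2 * Real.pi * s) x‖ ≤ (1 + ω * C) * ‖𝓕 g s‖ := by
    intro s
    -- The resolvent identity R(is')x = y + ω R(is')y, where s' = 2πs and y = 𝓕 g s solves the
    -- resolvent equation at ω + is'; hence the factor 1 + ωC.
    have h4 := (hR (2 * Real.pi * s)).eq_of_mem_graph (hgr s)
    have h5 : ((2 * Real.pi * s : ℝ) * Complex.I) • 𝓕 g s -
        (((ω : ℂ) + (2 * Real.pi * s : ℝ) * Complex.I) • 𝓕 g s - x) = x - (ω : ℂ) • 𝓕 g s := by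
      module
    rw [h5, map_sub, map_smul, sub_eq_iff_eq_add] at h4
    rw [h4, add_mul, one_mul]
    refine (norm_add_le _ _).trans (add_le_add le_rfl ?_)
    rw [norm_smul, Complex.norm_real, Real.norm_eq_abs, abs_of_nonneg hω, mul_assoc ω]
    exact mul_le_mul_of_nonneg_left ((R (2 * Real.pi * s)).le_of_opNorm_le (hC _) _) hω
  refine ⟨hpair.2.of_le_mul ((continuous_resolvent_line hR hC x).comp
    (continuous_const.mul continuous_id)).aestronglyMeasurable (Eventually.of_forall hle), ?_⟩
  refine (eLpNorm_le_mul_eLpNorm_of_ae_le_mul (Eventually.of_forall hle) 2).trans ?_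
  rw [hpair.eLpNorm_eq, mul_assoc, ENNReal.ofReal_mul hD0]
  gcongr

/-- The inverse Fourier transform of the resolvent solves the inhomogeneous Cauchy problem. -/
theorem IsFourierPair.add_one_sub_op_ae_eq (hA : T.IsGenerator A)
    (hR : ∀ s : ℝ, IsResolventAt A (s * Complex.I) (R s)) {x : H} {U : ℝ → H}
    (hU : IsFourierPair U fun s : ℝ => R (2 * Real.pi * s) x) :
    ∀ᵐ t : ℝ, U (t + 1) - T.op 1 (U t) =
      (Ioc (-1 : ℝ) 0).indicator (fun t => T.op (t + 1).toNNReal x) t := by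
  set k : ℝ → H := (Ioc (-1 : ℝ) 0).indicator (fun t => T.op (t + 1).toNNReal x) with hk
  have hkc : Continuous fun t : ℝ => T.op (t + 1).toNNReal x :=
    (T.continuous_orbit_real x).comp (continuous_id.add continuous_const)
  have hk1 : Integrable k :=
    (integrable_indicator_iff measurableSet_Ioc).2 (hkc.integrableOn_Ioc)
  have hk2 : MemLp k 2 := by
    rw [hk, memLp_indicator_iff_restrict measurableSet_Ioc]
    obtain ⟨K, hK⟩ := (isCompact_Icc (a := (-1 : ℝ)) (b := 0)).exists_bound_of_continuousOn
      hkc.continuousOn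
    refine MemLp.of_bound hkc.aestronglyMeasurable K ?_
    filter_upwards [ae_restrict_mem measurableSet_Ioc] with t ht using hK t (Ioc_subset_Icc_self ht)
  have h1 := (hU.translate 1).sub (hU.comp_clm (T.op 1))
  have h2 := isFourierPair_of_integrable hk1 hk2
  -- With z = 2πis the left side is (e^z - T(1))R(z)x = e^z ∫₀¹ e^{-zr} T(r)x dr. Substituting r = t
  -- + 1 turns it into the Fourier integral of k.
  have h3 : ((fun s : ℝ => Complex.exp (2 * Real.pi * (1 : ℝ) * Complex.I * s) •
      R (2 * Real.pi * s) x) - fun s : ℝ => T.op 1 (R (2 * Real.pi * s) x)) = 𝓕 k := by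
    ext s
    set z : ℂ := (2 * Real.pi * s : ℝ) * Complex.I with hz
    have h4 := hA.sub_exp_smul_op_eq ((hR (2 * Real.pi * s)).mem_graph x) zero_le_one
    rw [Real.toNNReal_one, ← hz] at h4
    rw [Real.fourier_real_eq_integral_exp_smul]
    have h5 : (fun t : ℝ => Complex.exp ((-2 * Real.pi * t * s : ℝ) * Complex.I) • k t) =
        (Ioc (-1 : ℝ) 0).indicator
          (fun t => Complex.exp (-z * t) • T.op (t + 1).toNNReal x) := by
      ext t
      by_cases ht : t ∈ Ioc (-1 : ℝ) 0
      · rw [hk, indicator_of_mem ht, indicator_of_mem ht]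
        congr 2
        rw [hz]
        push_cast
        ring
      · rw [hk, indicator_of_notMem ht, indicator_of_notMem ht, smul_zero]
    rw [h5, integral_indicator measurableSet_Ioc,
      ← intervalIntegral.integral_of_le (by norm_num : (-1 : ℝ) ≤ 0)]
    have h6 := intervalIntegral.integral_comp_add_right (a := (-1 : ℝ)) (b := 0)
      (fun r : ℝ => Complex.exp z • (Complex.exp (-z * r) • T.op r.toNNReal x)) 1
    have h7 : ∀ t : ℝ, Complex.exp z • (Complex.exp (-z * (t + 1 : ℝ)) • T.op (t + 1).toNNReal x) =
        Complex.exp (-z * t) • T.op (t + 1).toNNReal x := by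
      intro t
      rw [smul_smul, ← Complex.exp_add]
      congr 2
      push_cast
      ring
    simp only [h7] at h6
    rw [neg_add_cancel, zero_add, intervalIntegral.integral_smul, ← h4] at h6
    rw [h6, smul_sub, smul_smul, ← Complex.exp_add]
    simp only [Pi.sub_apply]
    congr 1
    · congr 2
      rw [hz]
      push_cast
      ring
    · simp
  rw [h3] at h1
  exact h1.left_unique h2

/-- A good offset t ∈ (-1, 0] has its ℓ² sum of U(t + n) at most the integral of ‖U‖², and the
recurrence holds exactly along t + ℤ. There the forcing occurs only at n = 0 and equals T(t + 1)x;
applying T(-t) makes it T(1)x, independent of t. -/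
theorem exists_discrete_solution (hA : T.IsGenerator A)
    (hR : ∀ s : ℝ, IsResolventAt A (s * Complex.I) (R s)) (hC : ∀ s, ‖R s‖ ≤ C) :
    ∃ K : ℝ, 0 ≤ K ∧ ∀ x : H, ∃ w : ℤ → H, (∀ n, n ≠ 0 → w (n + 1) = T.op 1 (w n)) ∧
      w 1 = T.op 1 (w 0) + T.op 1 x ∧ (Summable fun n => ‖w n‖ ^ 2) ∧
      ∑' n, ‖w n‖ ^ 2 ≤ K * ‖x‖ ^ 2 := by
  obtain ⟨K, hK0, hK⟩ := exists_eLpNorm_resolvent_le hA hR hC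
  obtain ⟨M, hM1, hM⟩ := T.exists_norm_op_le_of_le 1
  refine ⟨(M * K) ^ 2, by positivity, fun x => ?_⟩
  obtain ⟨U, hU⟩ := exists_isFourierPair_left (hK x).1
  have hUK : ∫⁻ t, ‖U t‖ₑ ^ 2 ≤ ENNReal.ofReal ((K * ‖x‖) ^ 2) := by
    rw [← eLpNorm_two_sq, ENNReal.ofReal_pow (by positivity), ← hU.eLpNorm_eq]
    gcongr
    exact (hK x).2
  have hUm : AEMeasurable fun t => ‖U t‖ₑ ^ 2 := hU.1.1.enorm.pow_const 2
  have hae : ∀ᵐ t : ℝ, ∀ n : ℤ, U (t + n + 1) - T.op 1 (U (t + n)) =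
      (Ioc (-1 : ℝ) 0).indicator (fun t => T.op (t + 1).toNNReal x) (t + n) :=
    ae_all_iff.2 fun n => (measurePreserving_add_right volume
      (n : ℝ)).quasiMeasurePreserving.ae (hU.add_one_sub_op_ae_eq hA hR)
  rw [lintegral_eq_setLIntegral_tsum hUm (-1), neg_add_cancel] at hUK
  have : IsProbabilityMeasure (volume.restrict (Ioc (-1 : ℝ) 0)) := ⟨by simp⟩
  obtain ⟨t, htN, ht⟩ := exists_notMem_null_le_lintegral
    (μ := volume.restrict (Ioc (-1 : ℝ) 0)) (f := fun t => ∑' n : ℤ, ‖U (t + n)‖ₑ ^ 2)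
    (AEMeasurable.tsum fun n => (hUm.comp_quasiMeasurePreserving
      (measurePreserving_add_right volume (n : ℝ)).quasiMeasurePreserving).restrict)
    ((ae_restrict_of_ae hae).and (ae_restrict_mem measurableSet_Ioc))
  simp only [mem_compl_iff, mem_ofPred_eq, not_not] at htN
  obtain ⟨hrec, ht1, ht0⟩ := htN
  have hsol : ∀ n : ℤ, T.op (-t).toNNReal (U (t + (n + 1 : ℤ))) =
      T.op 1 (T.op (-t).toNNReal (U (t + n))) + T.op (-t).toNNReal
        ((Ioc (-1 : ℝ) 0).indicator (fun t => T.op (t + 1).toNNReal x) (t + n)) := by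
    intro n
    rw [← hrec n, map_sub, T.op_comm 1]
    push_cast
    rw [add_assoc]
    abel
  have hMt : ‖T.op (-t).toNNReal‖ ≤ M := hM _ (by rw [Real.toNNReal_le_one]; linarith)
  refine ⟨fun n => T.op (-t).toNNReal (U (t + n)), fun n hn => ?_, ?_, ?_⟩
  · have hnot : t + n ∉ Ioc (-1 : ℝ) 0 := by
      rintro ⟨h1, h2⟩
      have h3 : (-1 : ℝ) < n := by linarith
      have h4 : (n : ℝ) < 1 := by linarith
      norm_cast at h3 h4
      omega
    simp only
    rw [hsol, indicator_of_notMem hnot, map_zero, add_zero]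
  · have hmem : t ∈ Ioc (-1 : ℝ) 0 := ⟨ht1, ht0⟩
    have := hsol 0
    rw [zero_add, Int.cast_zero, add_zero, indicator_of_mem hmem,
      ← T.op_add_apply (-t).toNNReal,
      ← Real.toNNReal_add (neg_nonneg.2 ht0) (by linarith : 0 ≤ t + 1)] at this
    simpa using this
  · refine summable_norm_sq_of_tsum_enorm_sq_le (by positivity) ?_
    calc ∑' n : ℤ, ‖T.op (-t).toNNReal (U (t + n))‖ₑ ^ 2
        ≤ ∑' n : ℤ, ENNReal.ofReal (M ^ 2) * ‖U (t + n)‖ₑ ^ 2 := by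
          refine ENNReal.tsum_le_tsum fun n => ?_
          rw [ENNReal.ofReal_pow (by positivity), ← mul_pow]
          gcongr
          rw [← ofReal_norm, ← ofReal_norm, ← ENNReal.ofReal_mul (by positivity)]
          exact ENNReal.ofReal_le_ofReal ((T.op _).le_of_opNorm_le hMt _)
      _ ≤ ENNReal.ofReal (M ^ 2) * ENNReal.ofReal ((K * ‖x‖) ^ 2) := by
          rw [ENNReal.tsum_mul_left]
          gcongr
          exact ht.trans hUK
      _ = ENNReal.ofReal ((M * K) ^ 2 * ‖x‖ ^ 2) := by
          rw [← ENNReal.ofReal_mul (by positivity)]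
          congr 1
          ring

/-- A continuous square integrable complete orbit vanishes when the resolvent set contains the
imaginary axis. -/
theorem eq_zero_of_complete_orbit (hA : T.IsGenerator A)
    (hR : ∀ s : ℝ, IsResolventAt A (s * Complex.I) (R s)) {U : ℝ → H} (hUc : Continuous U)
    (hU2 : MemLp U 2) (hU : ∀ (h : ℝ≥0) (t : ℝ), U (t + h) = T.op h (U t)) : U = 0 := by
  obtain ⟨V, hV⟩ := exists_isFourierPair_right hU2
  have hdense := TopologicalSpace.denseRange_denseSeq ℝ≥0
  -- For each h the eigenvector relation holds only almost everywhere in s. Countably many dense h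
  -- share one null set, and strong continuity then extends the relation to all h.
  have h1 : ∀ᵐ s : ℝ, ∀ n : ℕ, Complex.exp (2 * Real.pi *
      ((TopologicalSpace.denseSeq ℝ≥0 n : ℝ≥0) : ℝ) * Complex.I * s) • V s =
      T.op (TopologicalSpace.denseSeq ℝ≥0 n) (V s) := by
    rw [ae_all_iff]
    intro n
    have h2 := hV.translate ((TopologicalSpace.denseSeq ℝ≥0 n : ℝ≥0) : ℝ)
    simp only [hU] at h2
    exact h2.right_unique (hV.comp_clm _)
  have h2 : V =ᵐ[volume] 0 := by
    filter_upwards [h1] with s hs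
    have h3 : (fun h : ℝ≥0 => Complex.exp (2 * Real.pi * (h : ℝ) * Complex.I * s) • V s) =
        fun h => T.op h (V s) := by
      refine hdense.equalizer ?_ (T.continuous_orbit _) (funext hs)
      fun_prop
    have h4 : (V s, ((2 * Real.pi * s : ℝ) * Complex.I : ℂ) • V s) ∈ A.graph := by
      refine hA.graph_of_hasDerivAt
        (f := fun h : ℝ => Complex.exp (((2 * Real.pi * s : ℝ) * Complex.I) * h) • V s)
        (fun h => ?_) ?_
      · rw [← congrFun h3 h]
        congr 2
        push_cast
        ring
      · have := hasDerivAt_exp_smul_of ((2 * Real.pi * s : ℝ) * Complex.I)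
          (hasDerivAt_const (0 : ℝ) (V s))
        simpa using this
    -- V s would be an eigenvector for 2πis, a point of the resolvent set, so it vanishes.
    have h5 := (hR (2 * Real.pi * s)).eq_of_mem_graph h4
    simpa using h5.symm
  have h6 : IsFourierPair (0 : ℝ → H) (0 : ℝ → H) :=
    ⟨MemLp.zero, MemLp.zero, fun φ => by simp⟩
  have h7 := (hV.congr_right h2).left_unique h6
  exact (Continuous.ae_eq_iff_eq volume hUc continuous_const).1 h7

/-- The semigroup interpolates the sequence between consecutive integers to a continuous complete
orbit, and boundedness of T on [0, 1] turns ℓ² summability into square integrability. -/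
theorem eq_zero_of_discrete_orbit (hA : T.IsGenerator A)
    (hR : ∀ s : ℝ, IsResolventAt A (s * Complex.I) (R s)) {w : ℤ → H}
    (hw : ∀ n, w (n + 1) = T.op 1 (w n)) (hs : Summable fun n => ‖w n‖ ^ 2) (n : ℤ) : w n = 0 := by
  have hwm : ∀ (m : ℕ) (n : ℤ), w (n + m) = T.op m (w n) := by
    intro m n
    induction m with
    | zero => simp [T.op_zero_apply]
    | succ m ih => rw [Nat.cast_succ, ← add_assoc, hw, ih, ← T.op_add_apply, Nat.cast_succ, add_comm]
  set U : ℝ → H := fun t => T.op (t - ⌊t⌋).toNNReal (w ⌊t⌋) with hU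
  have hUn : ∀ (n : ℤ) (t : ℝ), (n : ℝ) ≤ t → U t = T.op (t - n).toNNReal (w n) := by
    intro n t hnt
    obtain ⟨m, hm⟩ := Int.eq_ofNat_of_zero_le (sub_nonneg.2 (Int.le_floor.2 hnt))
    have h1 : ⌊t⌋ = n + m := by omega
    have h2 : (m : ℝ≥0) = (m : ℝ).toNNReal := by simp
    rw [hU]
    simp only
    rw [h1, hwm, ← T.op_add_apply, h2, ← Real.toNNReal_add _ (by positivity)]
    · congr 3
      push_cast
      ring
    · rw [← h1]
      exact sub_nonneg.2 (Int.floor_le t)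
  have hUc : Continuous U := by
    rw [continuous_iff_continuousAt]
    intro t
    -- Starting one integer earlier makes a single orbit formula valid on a full neighbourhood of t,
    -- including when t is an integer.
    set n : ℤ := ⌊t⌋ - 1 with hn
    have hlt : (n : ℝ) < t := by rw [hn]; push_cast; linarith [Int.floor_le t]
    have hc : Continuous fun r : ℝ => T.op (r - n).toNNReal (w n) :=
      (T.continuous_orbit_real (w n)).comp (continuous_id.sub continuous_const)
    refine hc.continuousAt.congr ?_
    filter_upwards [lt_mem_nhds hlt] with r hr using (hUn n r hr.le).symm
  have hUh : ∀ (h : ℝ≥0) (t : ℝ), U (t + h) = T.op h (U t) := by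
    intro h t
    rw [hUn ⌊t⌋ t (Int.floor_le t), hUn ⌊t⌋ (t + h) ((Int.floor_le t).trans (by simp)),
      ← T.op_add_apply, add_sub_right_comm,
      Real.toNNReal_add (sub_nonneg.2 (Int.floor_le t)) h.coe_nonneg, Real.toNNReal_coe, add_comm]
  have hU2 : MemLp U 2 := by
    refine ⟨hUc.aestronglyMeasurable, ?_⟩
    obtain ⟨M, hM1, hM⟩ := T.exists_norm_op_le_of_le 1
    have hlt : ∫⁻ t, ‖U t‖ₑ ^ 2 < ⊤ := by
      rw [lintegral_eq_setLIntegral_tsum (hUc.enorm.measurable.pow_const 2).aemeasurable 0, zero_add]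
      have hle : ∀ t ∈ Ioc (0 : ℝ) 1, ∑' n : ℤ, ‖U (t + n)‖ₑ ^ 2 ≤
          ENNReal.ofReal (M ^ 2 * ∑' n, ‖w n‖ ^ 2) := by
        intro t ht
        rw [← tsum_mul_left, ENNReal.ofReal_tsum_of_nonneg (fun _ => by positivity)
          (hs.mul_left _)]
        refine ENNReal.tsum_le_tsum fun n => ?_
        rw [hUn n (t + n) (by linarith [ht.1]), add_sub_cancel_right, ← mul_pow,
          ENNReal.ofReal_pow (by positivity)]
        gcongr
        rw [← ofReal_norm]
        exact ENNReal.ofReal_le_ofReal ((T.op _).le_of_opNorm_le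
          (hM _ (Real.toNNReal_le_one.2 ht.2)) _)
      refine (setLIntegral_mono' measurableSet_Ioc hle).trans_lt ?_
      simp
    rw [← eLpNorm_two_sq] at hlt
    exact lt_of_not_ge fun h => by
      rw [top_le_iff.1 h] at hlt
      simp at hlt
  have h0 := congrFun (eq_zero_of_complete_orbit hA hR hUc hU2 hUh) n
  rw [hUn n n le_rfl] at h0
  simpa [T.op_zero_apply] using h0

/-- **Gearhart's theorem** for hyperbolic semigroups on Hilbert spaces. -/
theorem C0Semigroup.isHyperbolic_of_resolvent_bounded (hA : T.IsGenerator A)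
    (hR : ∀ s : ℝ, IsResolventAt A (s * Complex.I) (R s)) (hC : ∀ s, ‖R s‖ ≤ C) :
    T.IsHyperbolic := by
  obtain ⟨K, hK0, hK⟩ := exists_discrete_solution hA hR hC
  exact HasDiscreteDichotomy.isHyperbolic
    ⟨hK0, hK, fun w hw hs => eq_zero_of_discrete_orbit hA hR hw hs⟩

end Gearhart

/-! ### Neumann series with summable powers -/

section Neumann

variable {E : Type*} [NormedAddCommGroup E] [NormedSpace ℂ E] [CompleteSpace E]

/-- Neumann series for an operator with summable powers. -/
theorem exists_inverse_one_sub {a : E →L[ℂ] E} {K : ℝ} (hs : Summable fun n => ‖a ^ n‖)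
    (hK : ∑' n, ‖a ^ n‖ ≤ K) : ∃ N : E →L[ℂ] E, N * (1 - a) = 1 ∧ (1 - a) * N = 1 ∧ ‖N‖ ≤ K ∧
      ∀ b, Commute b a → Commute b N := by
  have hs' : Summable fun n => a ^ n := hs.of_norm
  have h0 := hs'.tsum_eq_zero_add
  rw [pow_zero] at h0
  have h1 : (∑' n, a ^ n) * (1 - a) = 1 := by
    have : (∑' n, a ^ n) * a = ∑' n, a ^ (n + 1) := by
      rw [← hs'.tsum_mul_right]
      simp only [pow_succ]
    rw [mul_sub, mul_one, this]
    nth_rw 1 [h0]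
    abel
  have h2 : (1 - a) * (∑' n, a ^ n) = 1 := by
    have : a * (∑' n, a ^ n) = ∑' n, a ^ (n + 1) := by
      rw [← hs'.tsum_mul_left]
      simp only [pow_succ']
    rw [sub_mul, one_mul, this]
    nth_rw 1 [h0]
    abel
  refine ⟨_, h1, h2, (norm_tsum_le_tsum_norm hs).trans hK, fun b hb => ?_⟩
  set N := ∑' n, a ^ n
  have h3 : b * (1 - a) = (1 - a) * b := by rw [mul_sub, sub_mul, hb.eq, mul_one, one_mul]
  calc b * N = N * (1 - a) * b * N := by rw [h1, one_mul]
    _ = N * (b * (1 - a)) * N := by rw [h3, mul_assoc N]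
    _ = N * b * ((1 - a) * N) := by simp only [mul_assoc]
    _ = N * b := by rw [h2, mul_one]

omit [CompleteSpace E] in
theorem summable_of_norm_pow_le {a : E →L[ℂ] E} {D q : ℝ} (hq0 : 0 ≤ q) (hq1 : q < 1)
    (h : ∀ n, ‖a ^ n‖ ≤ D * q ^ n) :
    (Summable fun n => ‖a ^ n‖) ∧ ∑' n, ‖a ^ n‖ ≤ D * (1 - q)⁻¹ := by
  have hg := (summable_geometric_of_lt_one hq0 hq1).mul_left D
  have hs := Summable.of_nonneg_of_le (fun n => norm_nonneg (a ^ n)) h hg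
  refine ⟨hs, (hs.tsum_le_tsum h hg).trans ?_⟩
  rw [tsum_mul_left, tsum_geometric_of_lt_one hq0 hq1]

end Neumann

/-! ### Resolvent bounds for hyperbolic semigroups -/

section HyperbolicResolvent

open C0Semigroup

variable {E : Type*} [NormedAddCommGroup E] [NormedSpace ℂ E] [CompleteSpace E]
  {T : C0Semigroup E} {A : E →ₗ.[ℂ] E}

omit [CompleteSpace E] in
theorem smul_mul_pow_norm {c : ℂ} (hc : ‖c‖ = 1) (a : E →L[ℂ] E) (n : ℕ) :
    ‖(c • a) ^ n‖ = ‖a ^ n‖ := by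
  rw [smul_pow, norm_smul, norm_pow, hc, one_pow, one_mul]

/-- The spectral projection of a hyperbolic semigroup, and the inverse of `T(1)` on the unstable
subspace. -/
theorem C0Semigroup.IsHyperbolic.exists_projection (hT : T.IsHyperbolic) :
    ∃ (P V : E →L[ℂ] E) (D q : ℝ), 0 ≤ q ∧ q < 1 ∧ P * P = P ∧ P * T.op 1 = T.op 1 * P ∧
      P * V = 0 ∧ T.op 1 * V = 1 - P ∧ V * T.op 1 = 1 - P ∧
      (∀ n, ‖(T.op 1 * P) ^ n‖ ≤ D * q ^ n) ∧ ∀ n, ‖V ^ n‖ ≤ D * q ^ n := by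
  obtain ⟨Es, Eu, hEs, hEu, hcompl, hinv, hbij, M, ε, hε, hs, hu⟩ := hT
  have htop := Submodule.IsCompl.isTopCompl_of_isClosed hcompl hEs hEu
  set P := Es.projectionL Eu htop with hP
  set Q := Eu.projectionL Es htop.symm with hQ
  have hPQ : ∀ x, P x + Q x = x := fun x => Submodule.projectionL_add_projectionL_eq_self htop x
  have hPs : ∀ x ∈ Es, P x = x := fun x hx => Submodule.projectionL_apply_left htop ⟨x, hx⟩
  have hPu : ∀ x ∈ Eu, P x = 0 := fun x hx => Submodule.projectionL_apply_right htop ⟨x, hx⟩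
  have hPm : ∀ x, P x ∈ Es := Submodule.projectionL_apply_mem htop
  have hQm : ∀ x, Q x ∈ Eu := Submodule.projectionL_apply_mem htop.symm
  have hQ1 : Q = 1 - P := by
    ext x
    exact eq_sub_of_add_eq' (hPQ x)
  have hPP : P * P = P := by
    ext x
    exact hPs _ (hPm x)
  have hPS : P * T.op 1 = T.op 1 * P := by
    ext x
    rw [mul_apply_eq_comp, mul_apply_eq_comp]
    nth_rw 1 [← hPQ x]
    rw [map_add, map_add, hPs _ (hinv 1 (hPm x)), hPu _ ((hbij 1).mapsTo (hQm x)), add_zero]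
  have hex : ∀ x, ∃ v ∈ Eu, T.op 1 v = Q x := fun x => (hbij 1).surjOn (hQm x)
  choose v hv hTv using hex
  have hinj : ∀ a ∈ Eu, ∀ b ∈ Eu, T.op 1 a = T.op 1 b → a = b :=
    fun a ha b hb h => (hbij 1).injOn ha hb h
  set V : E →L[ℂ] E := LinearMap.mkContinuous
    { toFun := v
      map_add' := fun x y => hinj _ (hv _) _ (Eu.add_mem (hv _) (hv _)) (by
        rw [map_add, hTv, hTv, hTv, map_add])
      map_smul' := fun c x => hinj _ (hv _) _ (Eu.smul_mem _ (hv _)) (by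
        rw [RingHom.id_apply, map_smul, hTv, hTv, map_smul]) }
    (|M| * Real.exp (-ε * (1 : ℝ≥0)) * ‖Q‖) (fun x => by
      have := hu 1 (v x) (hv x)
      rw [hTv] at this
      refine this.trans ?_
      rw [mul_assoc _ ‖Q‖]
      gcongr
      · exact le_abs_self M
      · exact Q.le_opNorm x) with hVdef
  have hVv : ∀ x, V x = v x := fun x => rfl
  have hVm : ∀ x, V x ∈ Eu := fun x => by rw [hVv]; exact hv x
  have hSV : T.op 1 * V = 1 - P := by
    ext x
    rw [mul_apply_eq_comp, hVv, hTv, hQ1]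
  have hVS : V * T.op 1 = 1 - P := by
    ext x
    rw [← hQ1, mul_apply_eq_comp, hVv]
    refine hinj _ (hv _) _ (hQm x) ?_
    rw [hTv, hQ1, ← mul_apply_eq_comp, ← mul_apply_eq_comp, sub_mul, mul_sub, hPS, one_mul, mul_one]
  have hPV : P * V = 0 := by
    ext x
    exact hPu _ (hVm x)
  -- The 1 covers the zeroth powers, which are the identity rather than a projection. The absolute
  -- value is needed because M is not assumed nonnegative.
  set D := max 1 (|M| * (‖P‖ + ‖Q‖)) with hD
  set q := Real.exp (-ε) with hq
  have hqn : ∀ n : ℕ, Real.exp (-ε * ((n : ℝ≥0) : ℝ)) = q ^ n := fun n => by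
    rw [hq, ← Real.exp_nat_mul, NNReal.coe_natCast, mul_comm]
  have hone : ∀ a : E →L[ℂ] E, ‖a ^ 0‖ ≤ D * q ^ 0 := fun a => by
    rw [pow_zero, pow_zero, mul_one]
    exact ContinuousLinearMap.norm_id_le.trans (le_max_left _ _)
  refine ⟨P, V, D, q, (Real.exp_pos _).le, Real.exp_lt_one_iff.2 (by linarith), hPP, hPS, hPV, hSV, hVS,
    fun n => ?_, fun n => ?_⟩
  · rcases n with _ | n
    · exact hone _
    have h1 : (T.op 1 * P) ^ (n + 1) = T.op 1 ^ (n + 1) * P := by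
      have hc : Commute (T.op 1) P := hPS.symm
      have hPi : IsIdempotentElem P := hPP
      rw [hc.mul_pow, hPi.pow_succ_eq]
    rw [h1]
    refine ContinuousLinearMap.opNorm_le_bound _ (by positivity) fun x => ?_
    rw [mul_apply_eq_comp, ← T.op_nat]
    refine (hs _ _ (hPm x)).trans ?_
    rw [hqn]
    calc M * q ^ (n + 1) * ‖P x‖ ≤ |M| * q ^ (n + 1) * ((‖P‖ + ‖Q‖) * ‖x‖) := by
          gcongr
          · exact le_abs_self M
          · refine (P.le_opNorm x).trans ?_
            gcongr
            linarith [norm_nonneg Q]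
      _ = |M| * (‖P‖ + ‖Q‖) * q ^ (n + 1) * ‖x‖ := by ring
      _ ≤ D * q ^ (n + 1) * ‖x‖ := by
          gcongr
          exact le_max_right _ _
  · rcases n with _ | n
    · exact hone _
    have hVp : ∀ n x, (V ^ (n + 1)) x ∈ Eu := fun n x => by
      rw [pow_succ', mul_apply_eq_comp]
      exact hVm _
    have h1 : ∀ n, T.op 1 ^ (n + 1) * V ^ (n + 1) = Q := by
      intro n
      induction n with
      | zero => rw [zero_add, pow_one, pow_one, hSV, hQ1]
      | succ n ih =>
        rw [pow_succ, pow_succ' V, mul_assoc, ← mul_assoc (T.op 1) V, hSV, sub_mul, one_mul]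
        rw [pow_succ' V, ← mul_assoc P, hPV, zero_mul, sub_zero, ← pow_succ' V, ih]
    refine ContinuousLinearMap.opNorm_le_bound _ (by positivity) fun x => ?_
    refine (hu (n + 1 : ℕ) _ (hVp n x)).trans ?_
    rw [T.op_nat, ← mul_apply_eq_comp, h1, hqn]
    calc M * q ^ (n + 1) * ‖Q x‖ ≤ |M| * q ^ (n + 1) * ((‖P‖ + ‖Q‖) * ‖x‖) := by
          gcongr
          · exact le_abs_self M
          · refine (Q.le_opNorm x).trans ?_
            gcongr
            linarith [norm_nonneg P]
      _ = |M| * (‖P‖ + ‖Q‖) * q ^ (n + 1) * ‖x‖ := by ring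
      _ ≤ D * q ^ (n + 1) * ‖x‖ := by
          gcongr
          exact le_max_right _ _

/-- On the stable part 1 - cS is inverted by the geometric series in cS; on the unstable part write
1 - cS = -cS(1 - c⁻¹S⁻¹) and use the series in c⁻¹S⁻¹. Both have bounds independent of c on the unit
circle. -/
theorem C0Semigroup.IsHyperbolic.exists_inverse (hT : T.IsHyperbolic) :
    ∃ K : ℝ, 0 ≤ K ∧ ∀ c : ℂ, ‖c‖ = 1 → ∃ J : E →L[ℂ] E, J * (1 - c • T.op 1) = 1 ∧
      (1 - c • T.op 1) * J = 1 ∧ ‖J‖ ≤ K := by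
  obtain ⟨P, V, D, q, hq0, hq1, hPP, hPS, hPV, hSV, hVS, hSn, hVn⟩ := hT.exists_projection
  set S := T.op 1 with hS
  have hD : 0 ≤ D := by simpa using (norm_nonneg _).trans (hSn 0)
  have h1q : 0 ≤ (1 - q)⁻¹ := inv_nonneg.2 (by linarith)
  refine ⟨‖P‖ * (D * (1 - q)⁻¹) + ‖V‖ * (D * (1 - q)⁻¹), by positivity, fun c hc => ?_⟩
  have hc0 : c ≠ 0 := fun h => by simp [h] at hc
  have hc' : ‖c⁻¹‖ = 1 := by rw [norm_inv, hc, inv_one]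
  obtain ⟨ha, ha'⟩ := summable_of_norm_pow_le hq0 hq1
    (fun n => (smul_mul_pow_norm hc (S * P) n).trans_le (hSn n))
  obtain ⟨hb, hb'⟩ := summable_of_norm_pow_le hq0 hq1
    (fun n => (smul_mul_pow_norm hc' V n).trans_le (hVn n))
  obtain ⟨A1, -, hA1, hA1K, hA1c⟩ := exists_inverse_one_sub ha ha'
  obtain ⟨B1, -, hB1, hB1K, hB1c⟩ := exists_inverse_one_sub hb hb'
  have hNP : (1 - c • S) * P = P * (1 - c • (S * P)) := by
    rw [sub_mul, mul_sub, one_mul, mul_one, smul_mul_assoc, mul_smul_comm, ← mul_assoc, hPS,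
      mul_assoc, hPP]
  have hNV : (1 - c • S) * (c⁻¹ • V) = -((1 - P) * (1 - c⁻¹ • V)) := by
    rw [sub_mul, smul_mul_assoc c, mul_smul_comm c⁻¹ S V, hSV, smul_smul, mul_inv_cancel₀ hc0, one_smul,
      one_mul, sub_mul, mul_sub P, mul_smul_comm, hPV]
    simp only [one_mul, mul_one, smul_zero, sub_zero]
    abel
  have hNJ : (1 - c • S) * (P * A1 - (c⁻¹ • V) * B1) = 1 := by
    rw [mul_sub, ← mul_assoc, hNP, mul_assoc, hA1, mul_one, ← mul_assoc, hNV, neg_mul, mul_assoc,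
      hB1, mul_one]
    abel
  have hcS : ∀ a : E →L[ℂ] E, Commute S a → Commute (1 - c • S) a := fun a h =>
    (Commute.one_left a).sub_left (h.smul_left c)
  have hSP : Commute S P := hPS.symm
  have hSV' : Commute S V := hSV.trans hVS.symm
  have hcomm : Commute (1 - c • S) (P * A1 - (c⁻¹ • V) * B1) := by
    refine Commute.sub_right (Commute.mul_right (hcS _ hSP) (hA1c _ (hcS _ ?_)))
      (Commute.mul_right (hcS _ (hSV'.smul_right _)) (hB1c _ (hcS _ (hSV'.smul_right _))))
    exact ((Commute.refl S).mul_right hSP).smul_right c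
  refine ⟨_, hcomm.eq.symm.trans hNJ, hNJ, (norm_sub_le _ _).trans ?_⟩
  gcongr
  · exact (norm_mul_le _ _).trans (by gcongr)
  · refine (norm_mul_le _ _).trans ?_
    rw [norm_smul, hc', one_mul]
    gcongr

omit [CompleteSpace E] in
theorem C0Semigroup.IsGenerator.map_mem_graph (hA : T.IsGenerator A) {J : E →L[ℂ] E}
    (hJ : ∀ t x, T.op t (J x) = J (T.op t x)) {x y : E} (h : (x, y) ∈ A.graph) :
    (J x, J y) ∈ A.graph := by
  rw [hA] at h ⊢
  refine ((J.continuous.tendsto _).comp h).congr fun t => ?_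
  simp only [Function.comp_apply]
  rw [ContinuousLinearMap.map_smul_of_tower, map_sub, hJ]

/-- The operator `x ↦ ∫_0^1 e^{-z r} T(r) x dr`. -/
theorem C0Semigroup.exists_truncated_laplace (T : C0Semigroup E) :
    ∃ M : ℝ, 0 ≤ M ∧ ∀ z : ℂ, z.re = 0 → ∃ W : E →L[ℂ] E, ‖W‖ ≤ M ∧
      ∀ x, W x = ∫ r in (0 : ℝ)..1, Complex.exp (-z * r) • T.op r.toNNReal x := by
  obtain ⟨M, hM1, hM⟩ := T.exists_norm_op_le_of_le 1
  have hM0 : 0 ≤ M := by linarith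
  refine ⟨M, hM0, fun z hz => ?_⟩
  have hint : ∀ x, IntervalIntegrable
      (fun r : ℝ => Complex.exp (-z * r) • T.op r.toNNReal x) volume 0 1 :=
    fun x => (T.continuous_exp_smul_orbit z x).intervalIntegrable _ _
  refine ⟨LinearMap.mkContinuous
    { toFun := fun x => ∫ r in (0 : ℝ)..1, Complex.exp (-z * r) • T.op r.toNNReal x
      map_add' := fun x y => by
        simp only [map_add, smul_add]
        exact intervalIntegral.integral_add (hint x) (hint y)
      map_smul' := fun c x => by
        rw [RingHom.id_apply, ← intervalIntegral.integral_smul]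
        simp only [map_smul, smul_comm c] } M (fun x => ?_),
    LinearMap.mkContinuous_norm_le _ hM0 _, fun x => rfl⟩
  have := intervalIntegral.norm_integral_le_of_norm_le_const (a := 0) (b := 1) (C := M * ‖x‖)
    (f := fun r : ℝ => Complex.exp (-z * r) • T.op r.toNNReal x) fun r hr => by
      rw [uIoc_of_le zero_le_one] at hr
      rw [norm_smul, Complex.norm_exp, show (-z * r).re = 0 by simp [hz], Real.exp_zero, one_mul]
      exact (T.op _).le_of_opNorm_le (hM _ (Real.toNNReal_le_one.2 hr.2)) x
  simpa using this

/-- The resolvent of the generator of a hyperbolic semigroup exists and is bounded on the imaginary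
axis. -/
theorem C0Semigroup.IsHyperbolic.exists_resolvent_bounded (hT : T.IsHyperbolic)
    (hA : T.IsGenerator A) :
    ∃ C : ℝ, ∀ s : ℝ, ∃ R, IsResolventAt A (s * Complex.I) R ∧ ‖R‖ ≤ C := by
  obtain ⟨K, hK0, hK⟩ := hT.exists_inverse
  obtain ⟨M, hM0, hM⟩ := T.exists_truncated_laplace
  refine ⟨K * M, fun s => ?_⟩
  set z : ℂ := s * Complex.I with hz
  have hre : z.re = 0 := by simp [hz]
  have hc : ‖Complex.exp (-z)‖ = 1 := by
    rw [Complex.norm_exp, Complex.neg_re, hre, neg_zero, Real.exp_zero]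
  obtain ⟨J, hJ1, hJ2, hJK⟩ := hK _ hc
  obtain ⟨W, hWM, hW⟩ := hM z hre
  have hJ1' : ∀ x, J (x - Complex.exp (-z) • T.op 1 x) = x := fun x =>
    congrArg (fun a : E →L[ℂ] E => a x) hJ1
  have hJ2' : ∀ x, J x - Complex.exp (-z) • T.op 1 (J x) = x := fun x =>
    congrArg (fun a : E →L[ℂ] E => a x) hJ2
  have hJT : ∀ t x, T.op t (J x) = J (T.op t x) := by
    intro t x
    have h1 := hJ1' (T.op t (J x))
    rw [T.op_comm 1 t, ← map_smul, ← map_sub, hJ2'] at h1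
    exact h1.symm
  -- If (z - A)y = x then (1 - e^{-z}T(1))y = Wx, so the resolvent must be J W; conversely J
  -- commutes with the semigroup and therefore preserves the graph of A.
  refine ⟨J * W, isResolventAt_of_graph (fun x => ?_) (fun x y h => ?_),
    (norm_mul_le _ _).trans (by gcongr)⟩
  · have h1 := hA.map_mem_graph hJT (hA.integral_mem_graph x z zero_le_one)
    rw [← hW, Complex.ofReal_one, mul_one, Real.toNNReal_one, map_sub, hJ1', map_smul] at h1
    exact h1
  · have h1 := hA.sub_exp_smul_op_eq (x := z • y - x) (y := y) (z := z)
      (by rwa [sub_sub_cancel]) zero_le_one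
    rw [← hW, Complex.ofReal_one, mul_one, Real.toNNReal_one] at h1
    rw [mul_apply_eq_comp, ← h1, hJ1']

end HyperbolicResolvent

/-! ### The resolvent of the nilpotent shift -/

section ShiftResolvent

/-- Integration by parts for a primitive of an integrable function. -/
theorem integral_deriv_smul_integral {X : Type*} [NormedAddCommGroup X] [NormedSpace ℂ X]
    [CompleteSpace X] {e e' : ℝ → ℂ} (he : ∀ s, HasDerivAt e (e' s) s) (he' : Continuous e')
    {h : ℝ → X} {t : ℝ} (ht : t ≤ 0) (hh : IntegrableOn h (Ioc t 0)) :
    ∫ s in t..0, e' s • ∫ r in s..0, h r =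
      (∫ r in t..0, e r • h r) - e t • ∫ r in t..0, h r := by
  have hec : Continuous e := continuous_iff_continuousAt.2 fun s => (he s).continuousAt
  set μ : Measure ℝ := volume.restrict (Ioc t 0) with hμ
  have hI : Integrable (fun p : ℝ × ℝ => {p : ℝ × ℝ | p.1 < p.2}.indicator
      (fun p => e' p.1 • h p.2) p) (μ.prod μ) := by
    have h1 : Integrable (fun p : ℝ × ℝ => e' p.1 • h p.2) (μ.prod μ) :=
      (he'.integrableOn_Ioc).integrable.smul_prod hh
    exact h1.indicator (measurableSet_lt measurable_fst measurable_snd)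
  -- Fubini on the triangle t < s < r ≤ 0 replaces the product rule, since h is only integrable.
  have hswap := integral_integral_swap (f := fun s r => {p : ℝ × ℝ | p.1 < p.2}.indicator
      (fun p => e' p.1 • h p.2) (s, r)) hI
  have hl : ∫ s in t..0, e' s • ∫ r in s..0, h r =
      ∫ s, ∫ r, {p : ℝ × ℝ | p.1 < p.2}.indicator (fun p => e' p.1 • h p.2) (s, r) ∂μ ∂μ := by
    rw [intervalIntegral.integral_of_le ht]
    refine setIntegral_congr_fun measurableSet_Ioc fun s hs => ?_
    have h1 : (fun r => {p : ℝ × ℝ | p.1 < p.2}.indicator (fun p => e' p.1 • h p.2) (s, r)) =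
        (Ioi s).indicator fun r => e' s • h r := by
      ext r
      by_cases hr : s < r
      · rw [indicator_of_mem (by exact hr), indicator_of_mem (by exact hr)]
      · rw [indicator_of_notMem (by exact hr), indicator_of_notMem (by exact hr)]
    rw [h1, integral_indicator measurableSet_Ioi, hμ, Measure.restrict_restrict measurableSet_Ioi,
      show Ioi s ∩ Ioc t 0 = Ioc s 0 by
        ext r; simp only [mem_inter_iff, mem_Ioi, mem_Ioc]
        exact ⟨fun h => ⟨h.1, h.2.2⟩, fun h => ⟨h.1, hs.1.trans h.1, h.2⟩⟩,
      integral_smul, intervalIntegral.integral_of_le hs.2]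
  have hr : ∫ r, ∫ s, {p : ℝ × ℝ | p.1 < p.2}.indicator (fun p => e' p.1 • h p.2) (s, r) ∂μ ∂μ =
      ∫ r in t..0, (e r • h r - e t • h r) := by
    rw [intervalIntegral.integral_of_le ht]
    refine setIntegral_congr_fun measurableSet_Ioc fun r hr => ?_
    have h1 : (fun s => {p : ℝ × ℝ | p.1 < p.2}.indicator (fun p => e' p.1 • h p.2) (s, r)) =
        (Iio r).indicator fun s => e' s • h r := by
      ext s
      by_cases hs : s < r
      · rw [indicator_of_mem (by exact hs), indicator_of_mem (by exact hs)]
      · rw [indicator_of_notMem (by exact hs), indicator_of_notMem (by exact hs)]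
    rw [h1, integral_indicator measurableSet_Iio, hμ, Measure.restrict_restrict measurableSet_Iio,
      show Iio r ∩ Ioc t 0 = Ioo t r by
        ext s; simp only [mem_inter_iff, mem_Iio, mem_Ioc, mem_Ioo]
        exact ⟨fun h => ⟨h.2.1, h.1⟩, fun h => ⟨h.2, h.1, h.2.le.trans hr.2⟩⟩,
      integral_smul_const, ← integral_Ioc_eq_integral_Ioo,
      ← intervalIntegral.integral_of_le hr.1.le,
      intervalIntegral.integral_eq_sub_of_hasDerivAt (fun s _ => he s)
        (he'.intervalIntegrable _ _), sub_smul]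
  have hh' : IntervalIntegrable h volume t 0 := (intervalIntegrable_iff_integrableOn_Ioc_of_le ht).2 hh
  have hh'' : IntervalIntegrable (fun r => e t • h r) volume t 0 := hh'.smul (e t)
  rw [hl, hswap, hr, intervalIntegral.integral_sub (hh'.continuousOn_smul hec.continuousOn) hh'',
    intervalIntegral.integral_smul]

variable {X : Type*} [NormedAddCommGroup X] [InnerProductSpace ℂ X] [CompleteSpace X]

/-- The solution of `z v - v' = g`, `v(0) = 0`. -/
noncomputable def shiftSol (z : ℂ) (g : ℝ → X) (t : ℝ) : X :=
  Complex.exp (z * t) • ∫ s in t..0, Complex.exp (-z * s) • g s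

omit [InnerProductSpace ℂ X] [CompleteSpace X] in
theorem integrableOn_L2 (g : L2 X) {t : ℝ} (ht : t ∈ Icc (-1 : ℝ) 0) : IntegrableOn g (Ioc t 0) := by
  have h : IntegrableOn g (Icc (-1 : ℝ) 0) volume := (Lp.memLp g).integrable (by norm_num)
  exact h.mono_set fun _ hs => ⟨ht.1.trans hs.1.le, hs.2⟩

omit [CompleteSpace X] in
theorem intervalIntegrable_exp_smul_L2 (z : ℂ) (g : L2 X) {t : ℝ} (ht : t ∈ Icc (-1 : ℝ) 0) :
    IntervalIntegrable (fun s : ℝ => Complex.exp (z * s) • g s) volume t 0 :=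
  ((intervalIntegrable_iff_integrableOn_Ioc_of_le ht.2).2 (integrableOn_L2 g ht)).continuousOn_smul
    (by fun_prop)

theorem shiftSol_eq (z : ℂ) (g : L2 X) {t : ℝ} (ht : t ∈ Icc (-1 : ℝ) 0) :
    shiftSol z g t = ∫ s in (0 : ℝ)..t, (z • shiftSol z g s - g s) := by
  have h1 : ∀ s : ℝ, HasDerivAt (fun s : ℝ => Complex.exp (z * s)) (z * Complex.exp (z * s)) s :=
    fun s => by simpa using C0Semigroup.hasDerivAt_exp_neg_mul (-z) s
  have hint := (intervalIntegrable_exp_smul_L2 (-z) g ht)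
  have h2 := integral_deriv_smul_integral h1 (by fun_prop) ht.2
    ((intervalIntegrable_iff_integrableOn_Ioc_of_le ht.2).1 hint)
  have h3 : ∀ s : ℝ, Complex.exp (z * s) • Complex.exp (-z * s) • g s = g s := fun s => by
    rw [smul_smul, ← Complex.exp_add]
    simp
  simp only [h3] at h2
  have h4 : ∀ s : ℝ, (z * Complex.exp (z * s)) • ∫ r in s..0, Complex.exp (-z * r) • g r =
      z • shiftSol z g s := fun s => by rw [shiftSol, smul_smul]
  simp only [h4] at h2
  have hg : IntervalIntegrable g volume t 0 := (intervalIntegrable_L2 g ht).symm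
  have hcont : IntervalIntegrable (fun s => z • shiftSol z g s) volume t 0 := by
    refine (ContinuousOn.intervalIntegrable ?_).smul z
    have : ContinuousOn (fun s : ℝ => ∫ r in s..0, Complex.exp (-z * r) • g r) (uIcc t 0) := by
      have := intervalIntegral.continuousOn_primitive_interval' (a := (0 : ℝ)) hint
        right_mem_uIcc
      refine this.neg.congr fun s _ => ?_
      rw [Pi.neg_apply, ← intervalIntegral.integral_symm]
    exact (by fun_prop : ContinuousOn (fun s : ℝ => Complex.exp (z * s)) (uIcc t 0)).smul this
  rw [intervalIntegral.integral_symm, intervalIntegral.integral_sub hcont hg, h2, shiftSol]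
  abel

/-- Variation of constants read backwards: a function with v(0) = 0 is recovered from zv - v'. This
is what makes the shift equation uniquely solvable. -/
theorem shiftSol_sub_eq (z : ℂ) {v w : L2 X} (h : IsPrimitive 0 v w) :
    v =ᵐ[histMeasure] shiftSol z (z • v - w : L2 X) := by
  filter_upwards [h, ae_restrict_mem measurableSet_Icc] with t hvt ht
  have h1 := integral_deriv_smul_integral (C0Semigroup.hasDerivAt_exp_neg_mul z) (by fun_prop) ht.2
    (integrableOn_L2 w ht)
  have h2 : ∀ᵐ s, s ∈ uIoc t 0 → Complex.exp (-z * s) • (z • v - w : L2 X) s =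
      (-z * Complex.exp (-z * s)) • (∫ r in s..0, w r) - Complex.exp (-z * s) • w s := by
    have h3 := (ae_restrict_iff' measurableSet_Icc).1
      (h.and ((Lp.coeFn_sub (z • v) w).and (Lp.coeFn_smul z v)))
    filter_upwards [h3] with s hs hst
    rw [uIoc_of_le ht.2] at hst
    obtain ⟨h4, h5, h6⟩ := hs ⟨ht.1.trans hst.1.le, hst.2⟩
    rw [h5, Pi.sub_apply, h6, Pi.smul_apply, h4, zero_add, intervalIntegral.integral_symm,
      smul_sub]
    module
  rw [shiftSol, intervalIntegral.integral_congr_ae h2, intervalIntegral.integral_sub, h1, hvt,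
    zero_add, intervalIntegral.integral_symm, sub_right_comm, sub_self, zero_sub, smul_neg,
    smul_smul, ← Complex.exp_add]
  · simp
  · refine ContinuousOn.intervalIntegrable (ContinuousOn.smul (by fun_prop) ?_)
    have := intervalIntegral.continuousOn_primitive_interval' (a := (0 : ℝ))
      (intervalIntegrable_L2 w ht).symm right_mem_uIcc
    refine this.neg.congr fun s _ => ?_
    rw [Pi.neg_apply, ← intervalIntegral.integral_symm]
  · exact intervalIntegrable_exp_smul_L2 (-z) w ht

/-- The history interval has length one, so L¹ ≤ L² ≤ L^∞ with constant 1; hence the bounds by 1 on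
the imaginary axis. -/
instance : IsProbabilityMeasure histMeasure := ⟨by simp [histMeasure]⟩

omit [InnerProductSpace ℂ X] [CompleteSpace X] in
theorem integral_norm_L2_le (g : L2 X) : ∫ s in Icc (-1 : ℝ) 0, ‖g s‖ ≤ ‖g‖ := by
  have h1 : eLpNorm g 1 histMeasure ≤ eLpNorm g 2 histMeasure :=
    eLpNorm_le_eLpNorm_of_exponent_le (by norm_num) (Lp.memLp g).1
  rw [integral_norm_eq_lintegral_enorm (Lp.memLp g).1, Lp.norm_def, ← eLpNorm_one_eq_lintegral_enorm]
  exact ENNReal.toReal_mono (Lp.memLp g).2.ne h1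

omit [CompleteSpace X] in
theorem norm_shiftSol_le {z : ℂ} (hz : z.re = 0) (g : L2 X) {t : ℝ} (ht : t ∈ Icc (-1 : ℝ) 0) :
    ‖shiftSol z g t‖ ≤ ‖g‖ := by
  have he : ∀ (w : ℂ) (s : ℝ), w.re = 0 → ‖Complex.exp (w * s)‖ = 1 := fun w s hw => by
    rw [Complex.norm_exp]; simp [hw]
  rw [shiftSol, norm_smul, he z t hz, one_mul]
  refine (intervalIntegral.norm_integral_le_integral_norm ht.2).trans ?_
  have : ∀ s : ℝ, ‖Complex.exp (-z * s) • g s‖ = ‖g s‖ := fun s => by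
    rw [norm_smul, he (-z) s (by simp [hz]), one_mul]
  simp only [this]
  refine le_trans ?_ (integral_norm_L2_le g)
  rw [intervalIntegral.integral_of_le ht.2]
  refine setIntegral_mono_set ?_ (Eventually.of_forall fun _ => norm_nonneg _) ?_
  · exact ((Lp.memLp g).integrable (by norm_num)).norm
  · exact LE.le.eventuallyLE fun s hs => ⟨ht.1.trans hs.1.le, hs.2⟩

theorem exists_isPrimitive_shift {z : ℂ} (hz : z.re = 0) (g : L2 X) :
    ∃ v : L2 X, IsPrimitive 0 v (z • v - g) ∧ ‖v‖ ≤ ‖g‖ := by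
  have hcont : ContinuousOn (shiftSol z g) (Icc (-1 : ℝ) 0) := by
    have hint := intervalIntegrable_exp_smul_L2 (-z) g (t := -1) (by simp)
    have := intervalIntegral.continuousOn_primitive_interval' (a := (0 : ℝ)) hint right_mem_uIcc
    rw [uIcc_of_le (by norm_num : (-1 : ℝ) ≤ 0)] at this
    have h2 : ContinuousOn (fun s : ℝ => ∫ r in s..0, Complex.exp (-z * r) • g r)
        (Icc (-1 : ℝ) 0) := this.neg.congr fun s _ => by
      rw [Pi.neg_apply, ← intervalIntegral.integral_symm]
    exact (by fun_prop : ContinuousOn (fun s : ℝ => Complex.exp (z * s)) (Icc (-1 : ℝ) 0)).smul h2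
  have hb : ∀ᵐ t ∂histMeasure, ‖shiftSol z g t‖ ≤ ‖g‖ := by
    filter_upwards [ae_restrict_mem measurableSet_Icc] with t ht using norm_shiftSol_le hz g ht
  have hm : MemLp (shiftSol z g) 2 histMeasure :=
    MemLp.of_bound (hcont.aestronglyMeasurable measurableSet_Icc) _ hb
  refine ⟨hm.toLp _, ?_, ?_⟩
  · filter_upwards [hm.coeFn_toLp, ae_restrict_mem measurableSet_Icc] with t h1 ht
    rw [h1, shiftSol_eq z g ht, zero_add]
    refine (integral_congr_L2 ?_ ht).symm
    filter_upwards [Lp.coeFn_sub (z • hm.toLp _) g, Lp.coeFn_smul z (hm.toLp _),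
      hm.coeFn_toLp] with s h2 h3 h4
    rw [h2, Pi.sub_apply, h3, Pi.smul_apply, h4]
  · have := Lp.norm_le_of_ae_bound (f := hm.toLp _) (norm_nonneg g)
      (by filter_upwards [hm.coeFn_toLp, hb] with t h1 h2 using by rwa [h1])
    simpa [measureUnivNNReal] using this

theorem IsPrimitive.shift_unique {z : ℂ} {g v v' : L2 X} (h : IsPrimitive 0 v (z • v - g))
    (h' : IsPrimitive 0 v' (z • v' - g)) : v = v' := by
  have h1 := shiftSol_sub_eq z h
  have h2 := shiftSol_sub_eq z h'
  rw [sub_sub_cancel] at h1 h2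
  exact Lp.ext (h1.trans h2.symm)

/-- The resolvent of the nilpotent shift on the imaginary axis. -/
theorem exists_shiftResolvent {z : ℂ} (hz : z.re = 0) :
    ∃ R : L2 X →L[ℂ] L2 X, (∀ g, IsPrimitive 0 (R g) (z • R g - g)) ∧ ‖R‖ ≤ 1 := by
  choose v hv hvn using exists_isPrimitive_shift (X := X) hz
  refine ⟨LinearMap.mkContinuous
    { toFun := v
      map_add' := fun g h => (hv _).shift_unique (by
        have := (hv g).add (hv h)
        rw [add_zero] at this
        convert! this using 1
        module)
      map_smul' := fun c g => (hv _).shift_unique (by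
        have := (hv g).smul c
        rw [smul_zero] at this
        convert! this using 1
        rw [RingHom.id_apply]
        module) } 1 (fun g => by simpa using hvn g), hv,
    LinearMap.mkContinuous_norm_le _ zero_le_one _⟩

end ShiftResolvent

/-! ### The resolvent of the delay operator matrix -/

section DelayResolvent

variable {X : Type*} [NormedAddCommGroup X] [InnerProductSpace ℂ X] [CompleteSpace X]

namespace W12

theorem isPrimitive_evalZero (u : W12 X) : IsPrimitive u.evalZero u.toL2 u.deriv :=
  u.2.choose_spec

theorem evalZero_eq {u : W12 X} {x : X} (h : IsPrimitive x u.toL2 u.deriv) : u.evalZero = x :=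
  (u.isPrimitive_evalZero.unique h).1

theorem exists_of_isPrimitive {x : X} {f g : L2 X} (h : IsPrimitive x f g) :
    ∃ u : W12 X, u.toL2 = f ∧ u.deriv = g ∧ u.evalZero = x := by
  set u : W12 X := ⟨WithLp.toLp 2 (f, g), x, h⟩ with hu
  exact ⟨u, rfl, rfl, evalZero_eq h⟩

theorem ofL2_toL2 (u : W12 X) (f : LinearMap.range (W12.toL2 : W12 X →ₗ[ℂ] L2 X))
    (hf : u.toL2 = f) : W12.ofL2 f = u := by
  have : f = LinearEquiv.ofInjective W12.toL2 W12.toL2_injective u := Subtype.ext hf.symm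
  rw [this]
  exact LinearEquiv.symm_apply_apply _ _

theorem expW12_toL2 (z : ℂ) (x : X) : (expW12 z x).toL2 = expL2 z x := rfl

theorem expW12_deriv (z : ℂ) (x : X) : (expW12 z x).deriv = z • expL2 z x := rfl

theorem expW12_evalZero (z : ℂ) (x : X) : (expW12 z x).evalZero = x :=
  evalZero_eq (isPrimitive_exp z x)

end W12

theorem norm_expL2_le {z : ℂ} (hz : z.re = 0) : ‖(expL2 z : X →L[ℂ] L2 X)‖ ≤ 1 := by
  refine ContinuousLinearMap.opNorm_le_bound _ zero_le_one fun x => ?_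
  have := Lp.norm_le_of_ae_bound (f := expL2 z x) (norm_nonneg x) (by
    filter_upwards [coeFn_expL2 z x] with t ht
    rw [ht, norm_smul, Complex.norm_exp]
    simp [hz])
  simpa [measureUnivNNReal] using this

theorem mem_graph_shiftGenerator {v w : L2 X} :
    (v, w) ∈ (shiftGenerator X).graph ↔ IsPrimitive 0 v w := by
  rw [LinearPMap.mem_graph_iff]
  constructor
  · rintro ⟨⟨f, hf⟩, rfl, hw⟩
    obtain ⟨u, hu, rfl⟩ := hf
    have h1 : shiftGenerator X ⟨W12.toL2 u, ⟨u, hu, rfl⟩⟩ = u.deriv :=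
      congrArg W12.deriv (W12.ofL2_toL2 u _ rfl)
    have h2 : w = u.deriv := hw.symm.trans h1
    have h3 := u.isPrimitive_evalZero
    rw [show u.evalZero = 0 from hu] at h3
    rw [h2]
    exact h3
  · intro h
    obtain ⟨u, rfl, rfl, hu⟩ := W12.exists_of_isPrimitive h
    exact ⟨⟨W12.toL2 u, ⟨u, hu, rfl⟩⟩, rfl, congrArg W12.deriv (W12.ofL2_toL2 u _ rfl)⟩

theorem isResolventAt_shiftGenerator {z : ℂ} {R : L2 X →L[ℂ] L2 X}
    (hR : ∀ g, IsPrimitive 0 (R g) (z • R g - g)) : IsResolventAt (shiftGenerator X) z R := by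
  refine isResolventAt_of_graph (fun g => mem_graph_shiftGenerator.2 (hR g)) fun w v h => ?_
  have h1 := mem_graph_shiftGenerator.1 h
  refine (hR _).shift_unique ?_
  rwa [sub_sub_cancel]

theorem delayResolvent_apply (Φ : W12 X →L[ℂ] X) {z : ℂ} {R : L2 X →L[ℂ] L2 X}
    (hR : ∀ g, IsPrimitive 0 (R g) (z • R g - g)) {g : L2 X} {u : W12 X} (hu : u.toL2 = R g) :
    delayResolvent Φ z g = Φ u := by
  refine congrArg Φ (W12.ofL2_toL2 u _ ?_)
  rw [hu, ← (isResolventAt_shiftGenerator hR).resolventOp_eq]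
  rfl

/-- Removes the chosen representatives from the operator: a Sobolev element is determined by its L²
function, so any u over the second component may be used. -/
theorem mem_graph_delayMatrix {B : X →ₗ.[ℂ] X} {Φ : W12 X →L[ℂ] X} {p r : StateSpace X} :
    (p, r) ∈ (delayMatrix B Φ).graph ↔ ∃ (u : W12 X) (b : X), u.toL2 = p.snd ∧
      u.evalZero = p.fst ∧ (p.fst, b) ∈ B.graph ∧ r = WithLp.toLp 2 (b + Φ u, u.deriv) := by
  have key : ∀ (hp : p ∈ (delayMatrix B Φ).domain) (u : W12 X), u.toL2 = p.snd →
      delayMatrix B Φ ⟨p, hp⟩ = WithLp.toLp 2 (B ⟨p.fst, hp.1⟩ + Φ u, u.deriv) := by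
    intro hp u hu
    have h1 := W12.ofL2_toL2 u ⟨p.snd, hp.2.choose, hp.2.choose_spec.1⟩ hu
    exact congrArg (fun f : W12 X => (WithLp.toLp 2 (B ⟨p.fst, hp.1⟩ + Φ f, f.deriv) :
      StateSpace X)) h1
  rw [LinearPMap.mem_graph_iff]
  constructor
  · rintro ⟨⟨p', hp⟩, rfl, hr⟩
    obtain ⟨u, hu, hu0⟩ := hp.2
    exact ⟨u, B ⟨p'.fst, hp.1⟩, hu, hu0, B.mem_graph ⟨p'.fst, hp.1⟩,
      hr.symm.trans (key hp u hu)⟩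
  · rintro ⟨u, b, hu, hu0, hb, rfl⟩
    obtain ⟨⟨x, hx⟩, hx1, rfl⟩ := (LinearPMap.mem_graph_iff _).1 hb
    simp only at hx1
    subst hx1
    exact ⟨⟨p, hx, u, hu, hu0⟩, rfl, key ⟨hx, u, hu, hu0⟩ u hu⟩

/-- The block operator `(x, f) ↦ (w, e w + R₀ f)` with `w = R N (x + F f)`. -/
theorem exists_block_operator {X Y : Type*} [NormedAddCommGroup X] [NormedSpace ℂ X]
    [NormedAddCommGroup Y] [NormedSpace ℂ Y] (RB N : X →L[ℂ] X) (F : Y →L[ℂ] X) (e : X →L[ℂ] Y)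
    (R0 : Y →L[ℂ] Y) {a b c : ℝ} (ha : ‖RB‖ ≤ a) (hb : ‖N‖ ≤ b) (hc : ‖F‖ ≤ c) (he : ‖e‖ ≤ 1)
    (h0 : ‖R0‖ ≤ 1) :
    ∃ R : WithLp 2 (X × Y) →L[ℂ] WithLp 2 (X × Y),
      (∀ p, (R p).fst = RB (N (p.fst + F p.snd)) ∧
        (R p).snd = e (RB (N (p.fst + F p.snd))) + R0 p.snd) ∧
      ‖R‖ ≤ 2 * (a * b * (1 + c)) + 1 := by
  have ha0 : 0 ≤ a := (norm_nonneg _).trans ha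
  have hb0 : 0 ≤ b := (norm_nonneg _).trans hb
  have hc0 : 0 ≤ c := (norm_nonneg _).trans hc
  set G : WithLp 2 (X × Y) →L[ℂ] X :=
    RB.comp (N.comp (WithLp.fstL 2 ℂ X Y + F.comp (WithLp.sndL 2 ℂ X Y))) with hG
  set K : WithLp 2 (X × Y) →L[ℂ] Y := e.comp G + R0.comp (WithLp.sndL 2 ℂ X Y) with hK
  have hGn : ∀ p, ‖G p‖ ≤ a * b * (1 + c) * ‖p‖ := by
    intro p
    have h1 : ‖p.fst + F p.snd‖ ≤ (1 + c) * ‖p‖ := by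
      refine (norm_add_le _ _).trans ?_
      rw [add_mul, one_mul]
      exact add_le_add (WithLp.norm_fst_le X p)
        (F.le_of_opNorm_le_of_le hc (WithLp.norm_snd_le X p))
    rw [mul_assoc, mul_assoc]
    exact RB.le_of_opNorm_le_of_le ha (N.le_of_opNorm_le_of_le hb h1)
  have hKn : ∀ p, ‖K p‖ ≤ (a * b * (1 + c) + 1) * ‖p‖ := by
    intro p
    refine (norm_add_le _ _).trans ?_
    rw [add_mul]
    refine add_le_add ?_ (R0.le_of_opNorm_le_of_le h0 (WithLp.norm_snd_le X p))
    have := e.le_of_opNorm_le_of_le he (hGn p)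
    rwa [one_mul] at this
  have hpair : ∀ (x : X) (f : Y), ‖(WithLp.toLp 2 (x, f) : WithLp 2 (X × Y))‖ ≤ ‖x‖ + ‖f‖ := by
    intro x f
    rw [WithLp.prod_norm_eq_of_L2]
    refine (Real.sqrt_le_left (by positivity)).2 ?_
    change ‖x‖ ^ 2 + ‖f‖ ^ 2 ≤ _
    nlinarith [mul_nonneg (norm_nonneg x) (norm_nonneg f)]
  refine ⟨(WithLp.prodContinuousLinearEquiv 2 ℂ X Y).symm.toContinuousLinearMap.comp (G.prod K),
    fun p => ⟨rfl, rfl⟩, ContinuousLinearMap.opNorm_le_bound _ (by positivity) fun p => ?_⟩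
  refine (hpair (G p) (K p)).trans ((add_le_add (hGn p) (hKn p)).trans (le_of_eq ?_))
  ring

/-- The resolvent of the delay matrix in terms of the resolvents of `B` and of the shift. -/
theorem exists_isResolventAt_delayMatrix {B : X →ₗ.[ℂ] X} {Φ : W12 X →L[ℂ] X} {z : ℂ}
    (hz : z.re = 0) {RB N : X →L[ℂ] X} (hRB : IsResolventAt B z RB)
    (hN1 : N * (1 - delayAt Φ z * RB) = 1) (hN2 : (1 - delayAt Φ z * RB) * N = 1)
    {F : L2 X →L[ℂ] X} (hF : F.toLinearMap = delayResolvent Φ z) {a b c : ℝ} (ha : ‖RB‖ ≤ a)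
    (hb : ‖N‖ ≤ b) (hc : ‖F‖ ≤ c) :
    ∃ R : StateSpace X →L[ℂ] StateSpace X, IsResolventAt (delayMatrix B Φ) z R ∧
      ‖R‖ ≤ 2 * (a * b * (1 + c)) + 1 := by
  obtain ⟨R0, hR0, hR0n⟩ := exists_shiftResolvent (X := X) hz
  have hFu : ∀ {g : L2 X} {u : W12 X}, u.toL2 = R0 g → F g = Φ u := fun {g u} hu => by
    rw [← delayResolvent_apply Φ hR0 hu, ← hF]; rfl
  have hN1' : ∀ x, N (x - delayAt Φ z (RB x)) = x := fun x =>
    congrArg (fun a : X →L[ℂ] X => a x) hN1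
  have hN2' : ∀ x, N x - delayAt Φ z (RB (N x)) = x := fun x =>
    congrArg (fun a : X →L[ℂ] X => a x) hN2
  obtain ⟨R, hR, hRn⟩ := exists_block_operator RB N F (expL2 z) R0 ha hb hc (norm_expL2_le hz) hR0n
  refine ⟨R, isResolventAt_of_graph (fun p => ?_) (fun r p h => ?_), hRn⟩
  · obtain ⟨u0, hu0, hu0', hu00⟩ := W12.exists_of_isPrimitive (hR0 p.snd)
    obtain ⟨hRx, hRf⟩ := hR p
    set w := N (p.fst + F p.snd) with hw
    refine mem_graph_delayMatrix.2 ⟨expW12 z (RB w) + u0, z • RB w - w, ?_, ?_, ?_, ?_⟩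
    · rw [map_add, hu0, hRf, W12.expW12_toL2]
    · rw [map_add, hu00, add_zero, W12.expW12_evalZero, hRx]
    · rw [hRx]; exact hRB.mem_graph w
    · refine WithLp.ofLp_injective 2 (Prod.ext ?_ ?_)
      · change z • (R p).fst - p.fst = z • RB w - w + Φ (expW12 z (RB w) + u0)
        -- N was inserted so that w - Φ_z R(z,B) w is exactly the data; the term Φ R(z,A₀)f
        -- contributed by the history part then cancels.
        have h1 : w - Φ (expW12 z (RB w)) = p.fst + F p.snd := hN2' (p.fst + F p.snd)
        rw [hRx, map_add, ← hFu hu0, eq_sub_of_add_eq h1.symm]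
        abel
      · change z • (R p).snd - p.snd = W12.deriv (expW12 z (RB w) + u0)
        rw [hRf, map_add, hu0', W12.expW12_deriv]
        module
  · obtain ⟨u, b', hu, hu0, hb', rfl⟩ := mem_graph_delayMatrix.1 h
    set q : StateSpace X := z • p - WithLp.toLp 2 (b' + Φ u, u.deriv) with hq
    have hq1 : q.fst = z • p.fst - (b' + Φ u) := rfl
    have hq2 : q.snd = z • p.snd - u.deriv := rfl
    obtain ⟨hRx, hRf⟩ := hR q
    have h1 : IsPrimitive 0 (u - expW12 z p.fst).toL2 (u - expW12 z p.fst).deriv := by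
      have := (u - expW12 z p.fst).isPrimitive_evalZero
      rwa [map_sub W12.evalZero, hu0, W12.expW12_evalZero, sub_self] at this
    -- Subtracting e^{z·}u(0) leaves the shift equation with the same right-hand side, but with
    -- value zero at 0.
    have h2 : R0 q.snd = (u - expW12 z p.fst).toL2 := by
      refine (hR0 _).shift_unique ?_
      convert! h1 using 1
      rw [hq2, map_sub, map_sub, W12.expW12_toL2, W12.expW12_deriv, hu]
      module
    have h3 : RB (z • p.fst - b') = p.fst := hRB.eq_of_mem_graph hb'
    have h4 : q.fst + F q.snd = (z • p.fst - b') - delayAt Φ z (RB (z • p.fst - b')) := by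
      rw [hFu h2.symm, hq1, h3, map_sub]
      change _ = _ - Φ (expW12 z p.fst)
      abel
    rw [h4, hN1', h3] at hRx hRf
    refine WithLp.ofLp_injective 2 (Prod.ext hRx ?_)
    change (R q).snd = p.snd
    rw [hRf, h2, map_sub, W12.expW12_toL2, hu]
    abel

/-- Summability in `ℝ≥0∞` of the norms of the powers gives a bounded Neumann series. -/
theorem exists_inverse_of_tsum_enorm_le {a : X →L[ℂ] X} {K : ℝ≥0∞} (hK : K < ⊤)
    (h : ∑' n : ℕ, ‖a ^ n‖ₑ ≤ K) :
    ∃ N : X →L[ℂ] X, N * (1 - a) = 1 ∧ (1 - a) * N = 1 ∧ ‖N‖ ≤ K.toReal := by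
  have hn : ∀ n, (‖a ^ n‖ₑ).toReal = ‖a ^ n‖ := fun n => toReal_enorm _
  have hne : ∑' n : ℕ, ‖a ^ n‖ₑ ≠ ⊤ := (h.trans_lt hK).ne
  have hs : Summable fun n => ‖a ^ n‖ := by
    simpa only [hn] using ENNReal.summable_toReal hne
  have hle : ∑' n, ‖a ^ n‖ ≤ K.toReal := by
    simp only [← hn]
    rw [← ENNReal.tsum_toReal_eq fun n => enorm_ne_top]
    exact ENNReal.toReal_mono hK.ne h
  obtain ⟨N, h1, h2, h3, -⟩ := exists_inverse_one_sub hs hle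
  exact ⟨N, h1, h2, h3⟩

end DelayResolvent

end DelayEq

/-! ### The main theorem: uniform resolvent bound on the imaginary axis -/

theorem mainTheorem1 {X : Type*} [NormedAddCommGroup X] [InnerProductSpace ℂ X] [CompleteSpace X]
    (B : X →ₗ.[ℂ] X) (Φ : DelayEq.W12 X →L[ℂ] X) (hΦ : DelayEq.IsAdmissible Φ)
    (hB : DelayEq.GeneratesHyperbolicSemigroup B)
    (ha : ∑' n : ℕ, ⨆ ω : ℝ,
      ‖((DelayEq.delayAt Φ (ω * Complex.I)).comp
        (DelayEq.resolventOp B (ω * Complex.I))) ^ n‖ₑ < ⊤) :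
    DelayEq.GeneratesHyperbolicSemigroup (DelayEq.delayMatrix B Φ) := by
  obtain ⟨S, hS, hSh⟩ := hB
  obtain ⟨hgen, F, hF, hFb⟩ := hΦ
  obtain ⟨T, hT⟩ := hgen B ⟨S, hS⟩
  refine ⟨T, hT, ?_⟩
  obtain ⟨CB, hCB⟩ := hSh.exists_resolvent_bounded hS
  -- Any negative abscissa would do: the open half-plane only has to contain the imaginary axis.
  obtain ⟨-, CF, hCF⟩ := hFb (-1)
  have hre : ∀ s : ℝ, ((s : ℂ) * Complex.I).re = 0 := fun s => by simp
  have key : ∀ s : ℝ, ∃ R, DelayEq.IsResolventAt (DelayEq.delayMatrix B Φ) (s * Complex.I) R ∧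
      ‖R‖ ≤ 2 * (CB * (∑' n : ℕ, ⨆ ω : ℝ, ‖((DelayEq.delayAt Φ (ω * Complex.I)).comp
        (DelayEq.resolventOp B (ω * Complex.I))) ^ n‖ₑ).toReal * (1 + CF)) + 1 := by
    intro s
    obtain ⟨RB, hRB, hRBn⟩ := hCB s
    have h1 : ∑' n : ℕ, ‖(DelayEq.delayAt Φ (s * Complex.I) * RB) ^ n‖ₑ ≤
        ∑' n : ℕ, ⨆ ω : ℝ, ‖((DelayEq.delayAt Φ (ω * Complex.I)).comp
          (DelayEq.resolventOp B (ω * Complex.I))) ^ n‖ₑ := by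
      refine ENNReal.tsum_le_tsum fun n => ?_
      rw [← hRB.resolventOp_eq]
      exact le_iSup (fun ω : ℝ => ‖((DelayEq.delayAt Φ (ω * Complex.I)).comp
        (DelayEq.resolventOp B (ω * Complex.I))) ^ n‖ₑ) s
    obtain ⟨N, hN1, hN2, hNn⟩ := DelayEq.exists_inverse_of_tsum_enorm_le ha h1
    exact DelayEq.exists_isResolventAt_delayMatrix (hre s) hRB hN1 hN2 (hF _) hRBn hNn
      (hCF _ (by rw [hre]; norm_num))
  choose R hR hRn using key
  exact DelayEq.C0Semigroup.isHyperbolic_of_resolvent_bounded hT hR hRn
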